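/- Let $(M,\tau)$ be a tracial $W^*$-probability space, i.e. $M$ is a von Neumann algebra and $\tau$ is a faithful normal tracial state on $M$; let $L^2(M,\tau)$ be the completion of $M$ with respect to the inner product $\langle a,b\rangle=\tau(ab^*)$. Let $X_1,\dots,X_n\in M$ be self-adjoint, and let $P(X)=P(X_1,\dots,X_n)$ denote the evaluation at $Z_i\mapsto X_i$ of a non-commutative polynomial $P\in\mathbb{C}\langle Z_1,\dots,Z_n\rangle$. Let $\partial_j:\mathbb{C}\langle Z_1,\dots,Z_n\rangle\to\mathbb{C}\langle Z_1,\dots,Z_n\rangle\otimes\mathbb{C}\langle Z_1,\dots,Z_n\rangle$ be the linear map with $\partial_j w=\sum_{w=uZ_jv}u\otimes v$ for monomials $w$. A conjugate system for $(X_1,\dots,X_n)$ is a tuple $(\xi_1,\dots,\xi_n)$ of elements of the closure $L^2(X_1,\dots,X_n,\tau)$ of $\{P(X): P\in\mathbb{C}\langle Z_1,\dots,Z_n\rangle\}$ in $L^2(M,\tau)$ such that $$(\tau\otimes\tau)\big((\partial_jP)(X_1,\dots,X_n)\big)=\tau(\xi_jP(X)),\qquad\text{where }\tau(\xi_jP(X)):=\langle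 \xi_j,P(X)^*\rangle,$$ for all $P\in\mathbb{C}\langle Z_1,\dots,Z_n\rangle$ and $j=1,\dots,n$; it is unique if it exists. The (non-microstates) free Fisher information is $\Phi^*(X_1,\dots,X_n):=\sum_{j=1}^n\|\xi_j\|_2^2$ if a conjugate system exists, and $\Phi^*(X_1,\dots,X_n):=\infty$ otherwise. Suppose that $\Phi^*(X_1,\dots,X_n)<\infty$. Let $P\in\mathbb{C}\langle Z_1,\dots,Z_n\rangle$ be non-constant and self-adjoint with respect to the conjugate-linear, multiplication-reversing involution with $Z_i^*=Z_i$. Then the distribution $\mu_{P(X)}$ of $P(X)$, i.e. the (existing and unique) probability measure $\mu$ on $\mathbb{R}$ with $\int_{\mathbb{R}}t^k\,d\mu(t)=\tau(P(X)^k)$ for $k=0,1,2,\dots$, has no atoms: $\mu_{P(X)}(\{t\})=0$ for every $t\in\mathbb{R}$. -/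

import Mathlib

open scoped ComplexOrder ComplexConjugate ENNReal TensorProduct InnerProductSpace
open MeasureTheory

/-! ### Non-commutative polynomials -/

/-- The algebra `ℂ⟨Z₁, …, Zₙ⟩` of non-commutative polynomials, with basis the words in `n` letters
and with concatenation of words as multiplication. -/
abbrev NCPoly (n : ℕ) : Type := MonoidAlgebra ℂ (FreeMonoid (Fin n))

namespace NCPoly

/-- The involution of `ℂ⟨Z₁, …, Zₙ⟩` for which the variables are self-adjoint:
`(∑ c_w w)^* = ∑ conj(c_w) w^{rev}`. -/
noncomputable def adjoint {n : ℕ} (P : NCPoly n) : NCPoly n :=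
  P.coeff.sum fun w c => MonoidAlgebra.single (FreeMonoid.reverse w) (conj c)

/-- `∂_j w = ∑_{w = u Z_j v} u ⊗ v` for a word `w`. -/
noncomputable def derivWord {n : ℕ} (j : Fin n) (w : FreeMonoid (Fin n)) :
    NCPoly n ⊗[ℂ] NCPoly n :=
  ∑ k : Fin w.toList.length,
    if w.toList.get k = j then
      (MonoidAlgebra.single (FreeMonoid.ofList (w.toList.take k)) 1 : NCPoly n) ⊗ₜ[ℂ]
        (MonoidAlgebra.single (FreeMonoid.ofList (w.toList.drop (k + 1))) 1 : NCPoly n)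
    else 0

/-- The non-commutative derivative `∂_j : ℂ⟨Z₁, …, Zₙ⟩ → ℂ⟨Z₁, …, Zₙ⟩ ⊗ ℂ⟨Z₁, …, Zₙ⟩`, the linear
extension of `derivWord`. -/
noncomputable def pderiv {n : ℕ} (j : Fin n) : NCPoly n →ₗ[ℂ] NCPoly n ⊗[ℂ] NCPoly n :=
  Finsupp.linearCombination ℂ (derivWord j) ∘ₗ
    (MonoidAlgebra.coeffLinearEquiv ℂ : NCPoly n ≃ₗ[ℂ] (FreeMonoid (Fin n) →₀ ℂ)).toLinearMap

/-- The evaluation homomorphism `P ↦ P(X₁, …, Xₙ)`, determined by `Z_i ↦ X_i`. -/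
noncomputable def ev {A : Type*} [Ring A] [Algebra ℂ A] {n : ℕ} (X : Fin n → A) :
    NCPoly n →ₐ[ℂ] A :=
  MonoidAlgebra.lift ℂ A (FreeMonoid (Fin n)) (FreeMonoid.lift X)

theorem ev_single {A : Type*} [Ring A] [Algebra ℂ A] {n : ℕ} (X : Fin n → A)
    (w : FreeMonoid (Fin n)) (c : ℂ) :
    ev X (MonoidAlgebra.single w c) = c • (w.toList.map X).prod := by
  simp [ev, FreeMonoid.lift_apply]

theorem ev_adjoint {A : Type*} [Ring A] [StarRing A] [Algebra ℂ A] [StarModule ℂ A] {n : ℕ}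
    (X : Fin n → A) (hX : ∀ j, IsSelfAdjoint (X j)) (P : NCPoly n) :
    ev X P.adjoint = star (ev X P) := by
  have key : ∀ w : List (Fin n), (w.reverse.map X).prod = star (w.map X).prod := by
    intro w
    induction w with
    | nil => simp
    | cons i w ih =>
      rw [List.reverse_cons, List.map_append, List.prod_append, ih, List.map_singleton,
        List.prod_singleton, List.map_cons, List.prod_cons, star_mul, (hX i).star_eq]
  rw [adjoint, Finsupp.sum, map_sum]
  conv_rhs => rw [ev, MonoidAlgebra.lift_apply, Finsupp.sum, star_sum]
  refine Finset.sum_congr rfl fun w _ => ?_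
  rw [ev_single, star_smul, FreeMonoid.lift_apply]
  exact congrArg _ (key w.toList)

end NCPoly

/-! ### Tracial `W^*`-probability spaces -/

section

variable {H : Type*} [NormedAddCommGroup H] [InnerProductSpace ℂ H] [CompleteSpace H]

/-- A faithful normal tracial state on a von Neumann algebra `M`. Normality means that suprema of
(bounded) upward directed families of positive elements are preserved; the order on `M` is the
usual order of operators on `H`. -/
structure FaithfulNormalTracialState (M : VonNeumannAlgebra H) where
  /-- the underlying linear functional -/
  toLinearMap : M.toStarSubalgebra →ₗ[ℂ] ℂ
  map_one : toLinearMap 1 = 1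
  nonneg : ∀ a, 0 ≤ toLinearMap (star a * a)
  tracial : ∀ a b, toLinearMap (a * b) = toLinearMap (b * a)
  faithful : ∀ a, toLinearMap (star a * a) = 0 → a = 0
  normal : ∀ (D : Set M.toStarSubalgebra) (s : M.toStarSubalgebra), D.Nonempty →
    DirectedOn (· ≤ ·) D → (∀ a ∈ D, 0 ≤ a) → IsLUB D s →
      IsLUB ((fun a => (toLinearMap a).re) '' D) (toLinearMap s).re

namespace FaithfulNormalTracialState

variable {M : VonNeumannAlgebra H} (τ : FaithfulNormalTracialState M)

theorem map_star (a : M.toStarSubalgebra) : τ.toLinearMap (star a) = conj (τ.toLinearMap a) := by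
  have h0 := (Complex.le_def.1 (τ.nonneg a)).2
  have h1 := (Complex.le_def.1 (τ.nonneg (a + 1))).2
  have h2 := (Complex.le_def.1 (τ.nonneg (a + Complex.I • 1))).2
  have e1 : star (a + 1) * (a + 1) = star a * a + star a + a + 1 := by
    rw [star_add, star_one]; noncomm_ring
  have e2 : star (a + Complex.I • 1) * (a + Complex.I • 1) =
      star a * a + Complex.I • star a - Complex.I • a + 1 := by
    rw [star_add, star_smul, star_one, add_mul, mul_add, mul_add]
    have e3 : Complex.I • Complex.I • (1 : M.toStarSubalgebra) = -1 := by
      rw [smul_smul, Complex.I_mul_I, neg_smul, one_smul]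
    simp only [smul_mul_assoc, mul_smul_comm, one_mul, mul_one, Complex.star_def,
      Complex.conj_I, neg_smul, smul_neg, neg_mul, e3]
    abel
  rw [e1] at h1
  rw [e2] at h2
  simp only [map_add, map_sub, map_smul, τ.map_one] at h1 h2
  simp at h0 h1 h2
  apply Complex.ext
  · simp; linarith
  · simp; linarith

/-- The algebra `M` with the inner product `⟪a, b⟫ = τ(a^* b)` (which is conjugate linear in the
first variable; by the trace property it equals `τ(b a^*)`). -/
def PreL2 (_τ : FaithfulNormalTracialState M) : Type _ := M.toStarSubalgebra

noncomputable instance : AddCommGroup τ.PreL2 := inferInstanceAs (AddCommGroup M.toStarSubalgebra)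

noncomputable instance : Module ℂ τ.PreL2 := inferInstanceAs (Module ℂ M.toStarSubalgebra)

/-- The identity map from `M` to `PreL2`. -/
noncomputable def toPreL2 : M.toStarSubalgebra ≃ₗ[ℂ] τ.PreL2 := LinearEquiv.refl ℂ _

/-- The inner product `⟪a, b⟫ = τ(a^* b)`. -/
noncomputable abbrev preL2Core : InnerProductSpace.Core ℂ τ.PreL2 where
  inner a b := τ.toLinearMap (star (τ.toPreL2.symm a) * τ.toPreL2.symm b)
  conj_inner_symm a b := by rw [← τ.map_star, star_mul, star_star]
  re_inner_nonneg a := (Complex.le_def.1 (τ.nonneg (τ.toPreL2.symm a))).1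
  add_left a b c := by simp only [map_add, star_add, add_mul]
  smul_left a b c := by
    simp only [map_smul, star_smul, smul_mul_assoc, smul_eq_mul]; rfl
  definite a h := τ.toPreL2.symm.map_eq_zero_iff.1 (τ.faithful _ h)

noncomputable instance : NormedAddCommGroup τ.PreL2 :=
  InnerProductSpace.Core.toNormedAddCommGroup (cd := τ.preL2Core)

noncomputable instance : InnerProductSpace ℂ τ.PreL2 :=
  InnerProductSpace.ofCore τ.preL2Core.toCore

/-- The Hilbert space `L²(M, τ)`. -/
abbrev L2 : Type _ := UniformSpace.Completion τ.PreL2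

/-- The canonical embedding `M → L²(M, τ)`. -/
noncomputable def toL2 : M.toStarSubalgebra →ₗ[ℂ] τ.L2 :=
  (UniformSpace.Completion.toComplL (𝕜 := ℂ) (E := τ.PreL2)).toLinearMap ∘ₗ
    τ.toPreL2.toLinearMap

theorem inner_toL2 (a b : M.toStarSubalgebra) :
    ⟪τ.toL2 a, τ.toL2 b⟫_ℂ = τ.toLinearMap (star a * b) :=
  UniformSpace.Completion.inner_coe _ _

/-! ### Conjugate systems and free Fisher information -/

/-- `τ(ξ a) = ⟨ξ, a^*⟩` for `ξ ∈ L²(M, τ)` and `a ∈ M`. -/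
noncomputable def traceMul (ξ : τ.L2) (a : M.toStarSubalgebra) : ℂ := ⟪τ.toL2 (star a), ξ⟫_ℂ

/-- `τ ⊗ τ` on the algebraic tensor product `M ⊗ M`. -/
noncomputable def tensorTrace : M.toStarSubalgebra ⊗[ℂ] M.toStarSubalgebra →ₗ[ℂ] ℂ :=
  LinearMap.mul' ℂ ℂ ∘ₗ TensorProduct.map τ.toLinearMap τ.toLinearMap

/-- `L²(X₁, …, Xₙ, τ)`: the closure of `ℂ⟨X₁, …, Xₙ⟩` in `L²(M, τ)`. -/
noncomputable def generatedL2 {n : ℕ} (X : Fin n → M.toStarSubalgebra) : Submodule ℂ τ.L2 :=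
  (LinearMap.range (τ.toL2 ∘ₗ (NCPoly.ev X).toLinearMap)).topologicalClosure

/-- The conjugate relations
`(τ ⊗ τ)((∂_j P)(X₁, …, Xₙ)) = τ(ξ_j P(X₁, …, Xₙ))`. -/
def SatisfiesConjugateRelations {n : ℕ} (X : Fin n → M.toStarSubalgebra) (ξ : Fin n → τ.L2) :
    Prop :=
  ∀ (j : Fin n) (P : NCPoly n),
    τ.tensorTrace (Algebra.TensorProduct.map (NCPoly.ev X) (NCPoly.ev X) (NCPoly.pderiv j P)) =
      τ.traceMul (ξ j) (NCPoly.ev X P)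

/-- `(ξ₁, …, ξₙ)` is the conjugate system for `(X₁, …, Xₙ)`. -/
def IsConjugateSystem {n : ℕ} (X : Fin n → M.toStarSubalgebra) (ξ : Fin n → τ.L2) : Prop :=
  τ.SatisfiesConjugateRelations X ξ ∧ ∀ j, ξ j ∈ τ.generatedL2 X

/-- The conjugate system is unique, so that the free Fisher information is well defined. -/
theorem IsConjugateSystem.unique {n : ℕ} {X : Fin n → M.toStarSubalgebra}
    (hX : ∀ j, IsSelfAdjoint (X j)) {ξ η : Fin n → τ.L2} (hξ : τ.IsConjugateSystem X ξ)
    (hη : τ.IsConjugateSystem X η) : ξ = η := by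
  funext j
  rw [← sub_eq_zero]
  have hmem : ξ j - η j ∈ τ.generatedL2 X := sub_mem (hξ.2 j) (hη.2 j)
  have horth : ξ j - η j ∈
      (LinearMap.range (τ.toL2 ∘ₗ (NCPoly.ev X).toLinearMap))ᗮ := by
    rw [Submodule.mem_orthogonal]
    rintro _ ⟨P, rfl⟩
    have h := (hξ.1 j P.adjoint).symm.trans (hη.1 j P.adjoint)
    rw [traceMul, traceMul, NCPoly.ev_adjoint X hX, star_star] at h
    rw [inner_sub_right, sub_eq_zero]
    exact h
  rw [← Submodule.orthogonal_closure] at horth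
  exact inner_self_eq_zero.1 ((Submodule.mem_orthogonal _ _).1 horth _ hmem)

open Classical in
/-- The (non-microstates) free Fisher information: `Φ^*(X₁, …, Xₙ) = ∑_j ‖ξ_j‖₂²` if the conjugate
system `(ξ₁, …, ξₙ)` exists, and `∞` otherwise. -/
noncomputable def freeFisherInformation {n : ℕ} (X : Fin n → M.toStarSubalgebra) : ℝ≥0∞ :=
  if h : ∃ ξ : Fin n → τ.L2, τ.IsConjugateSystem X ξ then
    ∑ j, ENNReal.ofReal (‖h.choose j‖ ^ 2)
  else ∞

/-! ### Distributions -/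

/-- `μ` is the distribution of the self-adjoint element `Y`: a probability measure on `ℝ` with
moments `∫ t^k dμ(t) = τ(Y^k)`. -/
structure IsDistribution (Y : M.toStarSubalgebra) (μ : Measure ℝ) : Prop where
  isProbabilityMeasure : IsProbabilityMeasure μ
  integrable : ∀ k : ℕ, Integrable (fun t : ℝ => t ^ k) μ
  moment : ∀ k : ℕ, τ.toLinearMap (Y ^ k) = ((∫ t : ℝ, t ^ k ∂μ : ℝ) : ℂ)

end FaithfulNormalTracialState

end

/-!
# Absence of atoms under finite free Fisher information

An atom of the distribution of `P(X)` at `t` means that `P(X) - t` has a nonzero kernel projection.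
That is excluded by showing that a nonzero polynomial `Q(X)` has no kernel, by induction on the
degree of `Q`.

Suppose `Q(X) u = 0` and `v Q(X) = 0`. Applying `∂_j` to `v Q u` and using the Leibniz rule gives
`(v ⊗ 1) (∂_j Q)(X) (1 ⊗ u) = 0`, provided that the terms in which `∂_j` hits `u` or `v` can be
controlled when `u` and `v` are merely limits of polynomials. This control is Dabrowski's inequality
`‖(id ⊗ τ)(∂_j P)‖₂ ≤ 2 ‖ξ_j‖₂ ‖P(X)‖`
(`TracialRep.IsConjugateVariable.norm_emb_rightDeriv_le`). It follows from the identity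
`‖∂_j^*(P ⊗ 1)‖₂² = ⟨ξ_j, ∂_j^*(P^* P ⊗ 1)⟩`, which expresses the coassociativity of `∂_j`, by
iterating it along the powers `(P^* P)^(2^k)`: crude linear bounds for the derivatives of these
powers disappear in the limit.

Now let `v` be the projection onto the kernel of `Q(X)^*`, whose trace equals that of the kernel
projection of `Q(X)`. Applying `τ ⊗ id` yields `Q'(X) u = 0` for `Q' = (τ(v ·) ⊗ id)(∂_j Q)`, a
polynomial of smaller degree. In top degree, `Q'` arises from `Q` by removing a leading letter `Z_j`
and multiplying by `τ(v)`, so if `τ(v) ≠ 0` then `Q' ≠ 0` for a suitable `j`, and the induction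
ends with a nonzero constant annihilating `u`.

Kernel projections are never formed: the projection onto the kernel of a contraction `x` is replaced
by the sequence of polynomials `(1 - x^* x)^k` (`NCPoly.defect`), its vanishing by convergence to
`0` in the `2`-norm, and the functional `τ(v ·)` by a limit along an ultrafilter. Moreover `M`
enters only through its left regular representation on `L²(M, τ)`, so the argument is carried out
for `*`-representations of the polynomials with a tracial vector (`TracialRep`). The induction is
`TracialRep.tendsto_emb_zero_of_mul`.

The distribution exists because `τ` is a vector state on `L²(M, τ)`
(`ContinuousLinearMap.exists_measure_moments`), and it is unique because its moments grow at most
geometrically (`MeasureTheory.Measure.ext_of_moments`).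
-/

/-! ### Words and the involution -/

namespace NCPoly

variable {n : ℕ}

/-- The monomial of a word, given as a list of letters. -/
noncomputable def word (w : List (Fin n)) : NCPoly n :=
  MonoidAlgebra.single (FreeMonoid.ofList w) 1

theorem word_nil : word ([] : List (Fin n)) = 1 := rfl

theorem word_append (v w : List (Fin n)) : word (v ++ w) = word v * word w := by
  simp [word, MonoidAlgebra.single_mul_single]

theorem word_cons (i : Fin n) (w : List (Fin n)) : word (i :: w) = word [i] * word w :=
  word_append [i] w

theorem coeff_word (v w : List (Fin n)) :
    (word v).coeff (FreeMonoid.ofList w) = if v = w then 1 else 0 := by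
  classical
  rw [word, MonoidAlgebra.coeff_single, Finsupp.single_apply]
  exact if_congr FreeMonoid.ofList.injective.eq_iff rfl rfl

@[elab_as_elim]
theorem induction_word {p : NCPoly n → Prop} (P : NCPoly n) (hw : ∀ w, p (word w))
    (hadd : ∀ P Q, p P → p Q → p (P + Q)) (hsmul : ∀ (c : ℂ) P, p P → p (c • P)) : p P := by
  induction P using MonoidAlgebra.induction_linear with
  | zero => simpa using hsmul 0 _ (hw [])
  | add P Q hP hQ => exact hadd P Q hP hQ
  | single w c =>
    have : MonoidAlgebra.single w c = c • word w.toList := by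
      simp [word]
    rw [this]
    exact hsmul c _ (hw _)

theorem adjoint_eq_sum (P : NCPoly n) : P.adjoint =
    Finsupp.sum P.coeff fun w c => MonoidAlgebra.single (FreeMonoid.reverse w) (conj c) := rfl

theorem adjoint_add (P Q : NCPoly n) : (P + Q).adjoint = P.adjoint + Q.adjoint := by
  classical
  simp only [adjoint_eq_sum, MonoidAlgebra.coeff_add]
  rw [Finsupp.sum_add_index'] <;> simp

theorem adjoint_smul (c : ℂ) (P : NCPoly n) : (c • P).adjoint = conj c • P.adjoint := by
  classical
  simp only [adjoint_eq_sum, MonoidAlgebra.coeff_smul]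
  rw [Finsupp.sum_smul_index' (by simp), Finsupp.smul_sum]
  simp

theorem adjoint_word (w : List (Fin n)) : (word w).adjoint = word w.reverse := by
  rw [adjoint_eq_sum, word, MonoidAlgebra.coeff_single, Finsupp.sum_single_index (by simp)]
  simp [word]
  rfl

/-- The involution as a conjugate-linear map. -/
noncomputable def adjointₛₗ : NCPoly n →ₛₗ[starRingEnd ℂ] NCPoly n where
  toFun := adjoint
  map_add' := adjoint_add
  map_smul' := adjoint_smul

theorem adjoint_sub (P Q : NCPoly n) : (P - Q).adjoint = P.adjoint - Q.adjoint :=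
  map_sub adjointₛₗ P Q

theorem adjoint_zero : (0 : NCPoly n).adjoint = 0 := map_zero adjointₛₗ

theorem adjoint_one : (1 : NCPoly n).adjoint = 1 := adjoint_word []

theorem adjoint_adjoint (P : NCPoly n) : P.adjoint.adjoint = P := by
  induction P using induction_word with
  | hw w => simp [adjoint_word]
  | hadd P Q hP hQ => rw [adjoint_add, adjoint_add, hP, hQ]
  | hsmul c P hP => rw [adjoint_smul, adjoint_smul, hP, Complex.conj_conj]

theorem adjoint_mul (P Q : NCPoly n) : (P * Q).adjoint = Q.adjoint * P.adjoint := by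
  induction P using induction_word with
  | hw v =>
    induction Q using induction_word with
    | hw w => simp [adjoint_word, ← word_append]
    | hadd P Q hP hQ => rw [mul_add, adjoint_add, hP, hQ, adjoint_add, add_mul]
    | hsmul c P hP => rw [mul_smul_comm, adjoint_smul, hP, adjoint_smul, smul_mul_assoc]
  | hadd P Q hP hQ => rw [add_mul, adjoint_add, hP, hQ, adjoint_add, mul_add]
  | hsmul c P hP => rw [smul_mul_assoc, adjoint_smul, hP, adjoint_smul, mul_smul_comm]

theorem adjoint_pow (P : NCPoly n) (k : ℕ) : (P ^ k).adjoint = P.adjoint ^ k := by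
  induction k with
  | zero => simp [adjoint_one]
  | succ k ih => rw [pow_succ, adjoint_mul, ih, pow_succ']

/-- The conjugate `P ↦ conj (ψ (P^*))` of a linear functional. -/
noncomputable def conjFunctional (ψ : NCPoly n →ₗ[ℂ] ℂ) : NCPoly n →ₗ[ℂ] ℂ where
  toFun P := conj (ψ P.adjoint)
  map_add' P Q := by simp [adjoint_add]
  map_smul' c P := by simp [adjoint_smul]

theorem conjFunctional_apply (ψ : NCPoly n →ₗ[ℂ] ℂ) (P : NCPoly n) :
    conjFunctional ψ P = conj (ψ P.adjoint) := rfl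

/-! ### Slices of the derivatives -/

theorem pderiv_word (j : Fin n) (w : List (Fin n)) :
    pderiv j (word w) = derivWord j (FreeMonoid.ofList w) := by
  simp [pderiv, word]

theorem pderiv_word_nil (j : Fin n) : pderiv j (word []) = 0 := by
  rw [pderiv_word]
  exact Finset.sum_empty

theorem pderiv_word_cons (j i : Fin n) (w : List (Fin n)) :
    pderiv j (word (i :: w)) = (if i = j then 1 ⊗ₜ[ℂ] word w else 0) +
      (word [i] ⊗ₜ[ℂ] 1) * pderiv j (word w) := by
  rw [pderiv_word, pderiv_word, derivWord, derivWord]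
  erw [Fin.sum_univ_succ]
  congr 1
  rw [Finset.mul_sum]
  refine Finset.sum_congr rfl fun k _ => ?_
  rw [mul_ite, mul_zero, Algebra.TensorProduct.tmul_mul_tmul, one_mul]
  have : (word [i] * MonoidAlgebra.single (FreeMonoid.ofList (w.take k)) 1 : NCPoly n) =
    MonoidAlgebra.single (FreeMonoid.ofList (i :: w.take k)) 1 := (word_cons i (w.take k)).symm
  erw [this]
  rfl

/-- `∂_j` is a derivation into the bimodule `ℂ⟨Z⟩ ⊗ ℂ⟨Z⟩`. -/
theorem pderiv_mul (j : Fin n) (P Q : NCPoly n) :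
    pderiv j (P * Q) = pderiv j P * (1 ⊗ₜ[ℂ] Q) + (P ⊗ₜ[ℂ] 1) * pderiv j Q := by
  induction P using induction_word with
  | hw v =>
    induction Q using induction_word with
    | hw w =>
      induction v with
      | nil =>
        rw [pderiv_word_nil, word_nil, one_mul, zero_mul, zero_add,
          ← Algebra.TensorProduct.one_def, one_mul]
      | cons i v ih =>
        have h1 : word (i :: v) ⊗ₜ[ℂ] (1 : NCPoly n) = (word [i] ⊗ₜ[ℂ] 1) * (word v ⊗ₜ[ℂ] 1) := by
          rw [Algebra.TensorProduct.tmul_mul_tmul, mul_one, ← word_cons]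
        rw [← word_append, List.cons_append, pderiv_word_cons, word_append, ih,
          pderiv_word_cons, h1, add_mul, mul_add, add_assoc, mul_assoc, mul_assoc]
        congr 1
        split_ifs
        · rw [Algebra.TensorProduct.tmul_mul_tmul, mul_one]
        · rw [zero_mul]
    | hadd P Q hP hQ =>
      rw [mul_add, map_add, hP, hQ, map_add, TensorProduct.tmul_add, mul_add, mul_add]; abel
    | hsmul c P hP =>
      rw [mul_smul_comm, map_smul, hP, map_smul, TensorProduct.tmul_smul, mul_smul_comm,
        mul_smul_comm, smul_add]
  | hadd P Q hP hQ =>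
    rw [add_mul, map_add, hP, hQ, map_add, TensorProduct.add_tmul, add_mul, add_mul]; abel
  | hsmul c P hP =>
    rw [smul_mul_assoc, map_smul, hP, map_smul, ← TensorProduct.smul_tmul', smul_mul_assoc,
      smul_mul_assoc, smul_add]

/-- The slice map `ψ ⊗ id`. -/
noncomputable def leftSlice (ψ : NCPoly n →ₗ[ℂ] ℂ) : NCPoly n ⊗[ℂ] NCPoly n →ₗ[ℂ] NCPoly n :=
  (TensorProduct.lid ℂ (NCPoly n)).toLinearMap ∘ₗ TensorProduct.map ψ LinearMap.id

/-- The slice map `id ⊗ χ`. -/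
noncomputable def rightSlice (χ : NCPoly n →ₗ[ℂ] ℂ) : NCPoly n ⊗[ℂ] NCPoly n →ₗ[ℂ] NCPoly n :=
  (TensorProduct.rid ℂ (NCPoly n)).toLinearMap ∘ₗ TensorProduct.map LinearMap.id χ

@[simp]
theorem leftSlice_tmul (ψ : NCPoly n →ₗ[ℂ] ℂ) (P Q : NCPoly n) :
    leftSlice ψ (P ⊗ₜ[ℂ] Q) = ψ P • Q := by
  simp [leftSlice]

@[simp]
theorem rightSlice_tmul (χ : NCPoly n →ₗ[ℂ] ℂ) (P Q : NCPoly n) :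
    rightSlice χ (P ⊗ₜ[ℂ] Q) = χ Q • P := by
  simp [rightSlice]

/-- The functional `P ↦ ψ (a P)`. -/
noncomputable def mulLeftArg (ψ : NCPoly n →ₗ[ℂ] ℂ) (a : NCPoly n) : NCPoly n →ₗ[ℂ] ℂ :=
  ψ ∘ₗ LinearMap.mulLeft ℂ a

/-- The functional `P ↦ χ (P b)`. -/
noncomputable def mulRightArg (χ : NCPoly n →ₗ[ℂ] ℂ) (b : NCPoly n) : NCPoly n →ₗ[ℂ] ℂ :=
  χ ∘ₗ LinearMap.mulRight ℂ b

@[simp]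
theorem mulLeftArg_apply (ψ : NCPoly n →ₗ[ℂ] ℂ) (a P : NCPoly n) :
    mulLeftArg ψ a P = ψ (a * P) := rfl

@[simp]
theorem mulRightArg_apply (χ : NCPoly n →ₗ[ℂ] ℂ) (b P : NCPoly n) :
    mulRightArg χ b P = χ (P * b) := rfl

theorem leftSlice_mul_right (ψ : NCPoly n →ₗ[ℂ] ℂ) (t : NCPoly n ⊗[ℂ] NCPoly n) (Q : NCPoly n) :
    leftSlice ψ (t * (1 ⊗ₜ[ℂ] Q)) = leftSlice ψ t * Q := by
  induction t using TensorProduct.induction_on with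
  | zero => simp
  | tmul a b => simp
  | add s t hs ht => rw [add_mul, map_add, hs, ht, map_add, add_mul]

theorem leftSlice_mul_left (ψ : NCPoly n →ₗ[ℂ] ℂ) (t : NCPoly n ⊗[ℂ] NCPoly n) (P : NCPoly n) :
    leftSlice ψ ((P ⊗ₜ[ℂ] 1) * t) = leftSlice (mulLeftArg ψ P) t := by
  induction t using TensorProduct.induction_on with
  | zero => simp
  | tmul a b => simp
  | add s t hs ht => rw [mul_add, map_add, hs, ht, map_add]

theorem rightSlice_mul_right (χ : NCPoly n →ₗ[ℂ] ℂ) (t : NCPoly n ⊗[ℂ] NCPoly n)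
    (Q : NCPoly n) : rightSlice χ (t * (1 ⊗ₜ[ℂ] Q)) = rightSlice (mulRightArg χ Q) t := by
  induction t using TensorProduct.induction_on with
  | zero => simp
  | tmul a b => simp
  | add s t hs ht => rw [add_mul, map_add, hs, ht, map_add]

theorem rightSlice_mul_left (χ : NCPoly n →ₗ[ℂ] ℂ) (t : NCPoly n ⊗[ℂ] NCPoly n)
    (P : NCPoly n) : rightSlice χ ((P ⊗ₜ[ℂ] 1) * t) = P * rightSlice χ t := by
  induction t using TensorProduct.induction_on with
  | zero => simp
  | tmul a b => simp
  | add s t hs ht => rw [mul_add, map_add, hs, ht, map_add, mul_add]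

/-- The operator `(ψ ⊗ id) ∘ ∂_j` on polynomials. -/
noncomputable def leftDeriv (j : Fin n) (ψ : NCPoly n →ₗ[ℂ] ℂ) : NCPoly n →ₗ[ℂ] NCPoly n :=
  leftSlice ψ ∘ₗ pderiv j

/-- The operator `(id ⊗ χ) ∘ ∂_j` on polynomials. -/
noncomputable def rightDeriv (j : Fin n) (χ : NCPoly n →ₗ[ℂ] ℂ) : NCPoly n →ₗ[ℂ] NCPoly n :=
  rightSlice χ ∘ₗ pderiv j

theorem leftDeriv_mul (j : Fin n) (ψ : NCPoly n →ₗ[ℂ] ℂ) (P Q : NCPoly n) :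
    leftDeriv j ψ (P * Q) = leftDeriv j ψ P * Q + leftDeriv j (mulLeftArg ψ P) Q := by
  simp only [leftDeriv, LinearMap.comp_apply, pderiv_mul, map_add, leftSlice_mul_right,
    leftSlice_mul_left]

theorem rightDeriv_mul (j : Fin n) (χ : NCPoly n →ₗ[ℂ] ℂ) (P Q : NCPoly n) :
    rightDeriv j χ (P * Q) = rightDeriv j (mulRightArg χ Q) P + P * rightDeriv j χ Q := by
  simp only [rightDeriv, LinearMap.comp_apply, pderiv_mul, map_add, rightSlice_mul_right,
    rightSlice_mul_left]

theorem leftDeriv_one (j : Fin n) (ψ : NCPoly n →ₗ[ℂ] ℂ) : leftDeriv j ψ 1 = 0 := by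
  rw [← word_nil, leftDeriv, LinearMap.comp_apply, pderiv_word_nil, map_zero]

theorem rightDeriv_one (j : Fin n) (χ : NCPoly n →ₗ[ℂ] ℂ) : rightDeriv j χ 1 = 0 := by
  rw [← word_nil, rightDeriv, LinearMap.comp_apply, pderiv_word_nil, map_zero]

theorem leftDeriv_word_cons (j i : Fin n) (ψ : NCPoly n →ₗ[ℂ] ℂ) (w : List (Fin n)) :
    leftDeriv j ψ (word (i :: w)) =
      (if i = j then ψ 1 else 0) • word w + leftDeriv j (mulLeftArg ψ (word [i])) (word w) := by
  rw [leftDeriv, LinearMap.comp_apply, pderiv_word_cons, map_add, leftSlice_mul_left]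
  split_ifs <;> simp [leftDeriv]

theorem rightDeriv_word_cons (j i : Fin n) (χ : NCPoly n →ₗ[ℂ] ℂ) (w : List (Fin n)) :
    rightDeriv j χ (word (i :: w)) =
      (if i = j then χ (word w) else 0) • 1 + word [i] * rightDeriv j χ (word w) := by
  rw [rightDeriv, LinearMap.comp_apply, pderiv_word_cons, map_add, rightSlice_mul_left]
  split_ifs <;> simp

/-- Both sides are `(ψ ⊗ χ)(∂_j P)`. -/
theorem apply_leftDeriv (j : Fin n) (ψ χ : NCPoly n →ₗ[ℂ] ℂ) (P : NCPoly n) :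
    χ (leftDeriv j ψ P) = ψ (rightDeriv j χ P) := by
  rw [leftDeriv, rightDeriv, LinearMap.comp_apply, LinearMap.comp_apply]
  induction pderiv j P using TensorProduct.induction_on with
  | zero => simp
  | tmul a b => simp [mul_comm]
  | add s t hs ht => simp only [map_add, hs, ht]

/-- Coassociativity of `∂_j`, after slicing: both sides are `(ψ ⊗ id ⊗ χ)` applied to
`(∂_j ⊗ id) ∂_j P = (id ⊗ ∂_j) ∂_j P`. -/
theorem leftDeriv_rightDeriv (j : Fin n) (ψ χ : NCPoly n →ₗ[ℂ] ℂ) (P : NCPoly n) :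
    leftDeriv j ψ (rightDeriv j χ P) = rightDeriv j χ (leftDeriv j ψ P) := by
  induction P using induction_word with
  | hw w =>
    induction w generalizing ψ with
    | nil => simp only [word_nil, leftDeriv_one, rightDeriv_one, map_zero]
    | cons i w ih =>
      have h1 : leftDeriv j ψ (word [i]) = (if i = j then ψ 1 else 0) • 1 := by
        rw [leftDeriv_word_cons, word_nil, leftDeriv_one, add_zero]
      rw [rightDeriv_word_cons, leftDeriv_word_cons, map_add, map_add, map_smul, map_smul,
        leftDeriv_one, smul_zero, zero_add, leftDeriv_mul, ih, h1, smul_mul_assoc, one_mul]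
  | hadd P Q hP hQ => simp only [map_add, hP, hQ]
  | hsmul c P hP => simp only [map_smul, hP]

/-- The involution exchanges the two kinds of slices. -/
theorem adjoint_rightDeriv (j : Fin n) (χ : NCPoly n →ₗ[ℂ] ℂ) (P : NCPoly n) :
    (rightDeriv j χ P).adjoint = leftDeriv j (conjFunctional χ) P.adjoint := by
  induction P using induction_word with
  | hw w =>
    induction w with
    | nil => simp only [word_nil, adjoint_one, leftDeriv_one, rightDeriv_one, adjoint_zero]
    | cons i w ih =>
      rw [adjoint_word, List.reverse_cons, word_append, leftDeriv_mul, ← adjoint_word, ← ih,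
        rightDeriv_word_cons, adjoint_add, adjoint_mul, adjoint_smul, adjoint_one,
        leftDeriv_word_cons, word_nil, leftDeriv_one, adjoint_word, List.reverse_singleton,
        add_zero, add_comm]
      congr 2
      split_ifs
      · rw [mulLeftArg_apply, mul_one, conjFunctional_apply, adjoint_adjoint]
      · rw [map_zero]
  | hadd P Q hP hQ => simp only [map_add, adjoint_add, hP, hQ]
  | hsmul c P hP => simp only [map_smul, adjoint_smul, hP]

/-! ### Degree -/

theorem coeff_leftDeriv_word_of_length_le (j : Fin n) (ψ : NCPoly n →ₗ[ℂ] ℂ)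
    (w v : List (Fin n)) (h : w.length ≤ v.length) :
    (leftDeriv j ψ (word w)).coeff (FreeMonoid.ofList v) = 0 := by
  induction w generalizing ψ with
  | nil => rw [word_nil, leftDeriv_one]; rfl
  | cons i w ih =>
    rw [List.length_cons] at h
    have hne : w ≠ v := by rintro rfl; omega
    rw [leftDeriv_word_cons, MonoidAlgebra.coeff_add, Finsupp.add_apply, ih _ (by omega),
      MonoidAlgebra.coeff_smul_apply, coeff_word, if_neg hne, smul_zero, add_zero]

/-- In top degree, `(ψ ⊗ id) ∂_j` removes a leading `Z_j` and multiplies by `ψ(1)`. -/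
theorem coeff_leftDeriv_word (j : Fin n) (ψ : NCPoly n →ₗ[ℂ] ℂ) (w v : List (Fin n))
    (h : w.length ≤ v.length + 1) :
    (leftDeriv j ψ (word w)).coeff (FreeMonoid.ofList v) =
      ψ 1 * (word w).coeff (FreeMonoid.ofList (j :: v)) := by
  cases w with
  | nil => rw [word_nil, leftDeriv_one, ← word_nil, coeff_word, if_neg (by simp), mul_zero]; rfl
  | cons i w =>
    rw [List.length_cons] at h
    rw [leftDeriv_word_cons, MonoidAlgebra.coeff_add, Finsupp.add_apply,
      coeff_leftDeriv_word_of_length_le _ _ _ _ (by omega), add_zero,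
      MonoidAlgebra.coeff_smul_apply, coeff_word, coeff_word]
    by_cases hi : i = j <;> by_cases hw : w = v <;> simp [hi, hw]

/-- `DegreeLE d P` means that all words occurring in `P` have length at most `d`. -/
def DegreeLE (d : ℕ) (P : NCPoly n) : Prop :=
  ∀ w : List (Fin n), d < w.length → P.coeff (FreeMonoid.ofList w) = 0

theorem eq_sum_word (P : NCPoly n) : P = ∑ w ∈ P.coeff.support, P.coeff w • word w.toList := by
  conv_lhs => rw [← MonoidAlgebra.sum_coeff_single P]
  refine Finset.sum_congr rfl fun w _ => ?_
  simp [word]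

theorem exists_degreeLE (P : NCPoly n) : ∃ d, DegreeLE d P := by
  refine ⟨P.coeff.support.sup fun w => w.toList.length, fun w hw => ?_⟩
  by_contra h
  exact absurd (Finset.le_sup (f := fun w : FreeMonoid (Fin n) => w.toList.length)
    (Finsupp.mem_support_iff.2 h)) (not_le.2 hw)

theorem DegreeLE.coeff_leftDeriv {d : ℕ} {P : NCPoly n} (hP : DegreeLE d P) (j : Fin n)
    (ψ : NCPoly n →ₗ[ℂ] ℂ) (v : List (Fin n)) (h : d ≤ v.length + 1) :
    (leftDeriv j ψ P).coeff (FreeMonoid.ofList v) =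
      ψ 1 * P.coeff (FreeMonoid.ofList (j :: v)) := by
  have hlen : ∀ w ∈ P.coeff.support, w.toList.length ≤ v.length + 1 := by
    intro w hw
    by_contra hlt
    exact Finsupp.mem_support_iff.1 hw (hP w.toList (by omega))
  conv_lhs => rw [eq_sum_word P]
  conv_rhs => rw [eq_sum_word P]
  rw [map_sum, MonoidAlgebra.coeff_sum, MonoidAlgebra.coeff_sum, Finsupp.finsetSum_apply,
    Finsupp.finsetSum_apply, Finset.mul_sum]
  refine Finset.sum_congr rfl fun w hw => ?_
  rw [map_smul, MonoidAlgebra.coeff_smul_apply, MonoidAlgebra.coeff_smul_apply,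
    coeff_leftDeriv_word _ _ _ _ (hlen w hw), smul_eq_mul, smul_eq_mul, mul_left_comm]

theorem DegreeLE.leftDeriv {d : ℕ} {P : NCPoly n} (hP : DegreeLE (d + 1) P) (j : Fin n)
    (ψ : NCPoly n →ₗ[ℂ] ℂ) : DegreeLE d (leftDeriv j ψ P) := by
  intro v hv
  rw [hP.coeff_leftDeriv j ψ v (by omega), hP _ (by simpa using hv), mul_zero]

theorem DegreeLE.eq_smul_one {P : NCPoly n} (hP : DegreeLE 0 P) :
    P = P.coeff 1 • 1 := by
  apply MonoidAlgebra.coeff_injective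
  ext w
  rw [MonoidAlgebra.coeff_smul_apply, ← word_nil]
  cases hw : w.toList with
  | nil =>
    have : w = FreeMonoid.ofList [] := hw
    rw [this, coeff_word]
    simp
  | cons i v =>
    have : w = FreeMonoid.ofList (i :: v) := hw
    rw [this, coeff_word, if_neg (by simp), hP _ (by simp), smul_zero]

/-- Either the degree bound can be lowered, or some slice of a derivative is nonzero. -/
theorem DegreeLE.exists_leftDeriv_ne_zero {d : ℕ} {P : NCPoly n} (hP : DegreeLE (d + 1) P)
    (h : ¬ DegreeLE d P) :
    ∃ j, ∀ ψ : NCPoly n →ₗ[ℂ] ℂ, ψ 1 ≠ 0 → NCPoly.leftDeriv j ψ P ≠ 0 := by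
  rw [DegreeLE] at h
  push Not at h
  obtain ⟨w, hw, hne⟩ := h
  cases w with
  | nil => simp at hw
  | cons j v =>
    rw [List.length_cons] at hw
    refine ⟨j, fun ψ hψ h0 => ?_⟩
    have := hP.coeff_leftDeriv j ψ v (by omega)
    rw [h0] at this
    exact mul_ne_zero hψ hne this.symm

end NCPoly

/-! ### Tracial representations and Dabrowski's inequalities -/

/-- If `x k ^ 2 ≤ x (k + 1)`, then `x 0 > 1` would make `x k` grow like `(x 0) ^ 2 ^ k`, which no
bound linear in `2 ^ k` allows. -/
theorem le_one_of_sq_le_succ {x : ℕ → ℝ} {A B : ℝ} (h0 : ∀ k, 0 ≤ x k)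
    (hsq : ∀ k, x k ^ 2 ≤ x (k + 1)) (hx : ∀ k, x k ≤ A + 2 ^ k * B) : x 0 ≤ 1 := by
  by_contra! h
  have hpow : ∀ k, x 0 ^ 2 ^ k ≤ x k := by
    intro k
    induction k with
    | zero => simp
    | succ k ih =>
      rw [pow_succ, pow_mul]
      exact (pow_le_pow_left₀ (by positivity [h0 0]) ih 2).trans (hsq k)
  have hx0 : 0 ≤ x 0 := h0 0
  have l1 : Filter.Tendsto (fun m : ℕ => ((m : ℝ) ^ 0 / x 0 ^ m) * A + ((m : ℝ) ^ 1 / x 0 ^ m) * B)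
      Filter.atTop (nhds (0 * A + 0 * B)) :=
    ((tendsto_pow_const_div_const_pow_of_one_lt 0 h).mul_const A).add
      ((tendsto_pow_const_div_const_pow_of_one_lt 1 h).mul_const B)
  have l2 := l1.comp (tendsto_pow_atTop_atTop_of_one_lt (α := ℕ) (r := 2) one_lt_two)
  refine absurd (ge_of_tendsto' l2 (b := 1) fun k => ?_) (by norm_num)
  have hpos : 0 < x 0 ^ 2 ^ k := by positivity
  have := (hpow k).trans (hx k)
  simp only [Function.comp_apply, pow_zero, pow_one, Nat.cast_pow, Nat.cast_ofNat]
  rw [div_mul_eq_mul_div, div_mul_eq_mul_div, ← add_div, le_div_iff₀ hpos]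
  linarith

section

variable {n : ℕ} {K : Type*} [NormedAddCommGroup K] [InnerProductSpace ℂ K] [CompleteSpace K]

variable (n K) in
/-- A `*`-representation of `ℂ⟨Z₁, …, Zₙ⟩` by bounded operators on a Hilbert space, together with
a vector whose vector state is a trace. -/
structure TracialRep where
  /-- the representation -/
  rep : NCPoly n →ₐ[ℂ] (K →L[ℂ] K)
  /-- the tracial vector -/
  vec : K
  rep_adjoint : ∀ P, rep P.adjoint = star (rep P)
  tracial : ∀ P Q, ⟪vec, rep (P * Q) vec⟫_ℂ = ⟪vec, rep (Q * P) vec⟫_ℂ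

namespace TracialRep

open NCPoly

variable (ρ : TracialRep n K)

/-- The map `P ↦ P Ω` to the Hilbert space, where `Ω` is the tracial vector. -/
noncomputable def emb : NCPoly n →ₗ[ℂ] K where
  toFun P := ρ.rep P ρ.vec
  map_add' P Q := by rw [map_add, add_apply]
  map_smul' c P := by rw [map_smul, smul_apply, RingHom.id_apply]

theorem emb_apply (P : NCPoly n) : ρ.emb P = ρ.rep P ρ.vec := rfl

/-- The trace `P ↦ ⟨Ω, P Ω⟩`. -/
noncomputable def trace : NCPoly n →ₗ[ℂ] ℂ where
  toFun P := ⟪ρ.vec, ρ.rep P ρ.vec⟫_ℂ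
  map_add' P Q := by rw [map_add, add_apply, inner_add_right]
  map_smul' c P := by
    rw [map_smul, smul_apply, inner_smul_right, RingHom.id_apply, smul_eq_mul]

theorem trace_mul_comm (P Q : NCPoly n) : ρ.trace (P * Q) = ρ.trace (Q * P) := ρ.tracial P Q

theorem emb_mul (P Q : NCPoly n) : ρ.emb (P * Q) = ρ.rep P (ρ.emb Q) := by
  rw [emb_apply, map_mul]; rfl

theorem inner_rep_left (P : NCPoly n) (x y : K) :
    ⟪ρ.rep P x, y⟫_ℂ = ⟪x, ρ.rep P.adjoint y⟫_ℂ := by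
  rw [ρ.rep_adjoint, ContinuousLinearMap.star_eq_adjoint,
    ContinuousLinearMap.adjoint_inner_right]

theorem inner_emb (P Q : NCPoly n) : ⟪ρ.emb P, ρ.emb Q⟫_ℂ = ρ.trace (P.adjoint * Q) := by
  rw [emb_apply, inner_rep_left, ← emb_mul]; rfl

theorem trace_adjoint (P : NCPoly n) : ρ.trace P.adjoint = conj (ρ.trace P) := by
  have h := ρ.inner_emb P 1
  have h' := ρ.inner_emb 1 P
  rw [mul_one] at h
  rw [adjoint_one, one_mul] at h'
  rw [← h, ← h', inner_conj_symm]

theorem conjFunctional_trace : conjFunctional ρ.trace = ρ.trace := by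
  refine LinearMap.ext fun P => ?_
  rw [conjFunctional_apply, trace_adjoint, Complex.conj_conj]

theorem trace_adjoint_mul_self (P : NCPoly n) :
    ρ.trace (P.adjoint * P) = ((‖ρ.emb P‖ ^ 2 : ℝ) : ℂ) := by
  rw [← inner_emb, inner_self_eq_norm_sq_to_K]
  push_cast
  rfl

theorem norm_emb_adjoint (P : NCPoly n) : ‖ρ.emb P.adjoint‖ = ‖ρ.emb P‖ := by
  have h := ρ.trace_adjoint_mul_self P.adjoint
  rw [adjoint_adjoint, trace_mul_comm, trace_adjoint_mul_self] at h
  exact (pow_left_inj₀ (norm_nonneg _) (norm_nonneg _) two_ne_zero).1 (by exact_mod_cast h.symm)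

theorem norm_rep_adjoint (P : NCPoly n) : ‖ρ.rep P.adjoint‖ = ‖ρ.rep P‖ := by
  rw [rep_adjoint, norm_star]

theorem norm_emb_mul_le_rep_mul (P Q : NCPoly n) :
    ‖ρ.emb (P * Q)‖ ≤ ‖ρ.rep P‖ * ‖ρ.emb Q‖ := by
  rw [emb_mul]
  exact (ρ.rep P).le_opNorm _

theorem norm_emb_mul_le_mul_rep (P Q : NCPoly n) :
    ‖ρ.emb (P * Q)‖ ≤ ‖ρ.emb P‖ * ‖ρ.rep Q‖ := by
  rw [← norm_emb_adjoint, adjoint_mul, mul_comm, ← ρ.norm_emb_adjoint P, ← norm_rep_adjoint]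
  exact ρ.norm_emb_mul_le_rep_mul _ _

theorem norm_trace_mul_le (P Q : NCPoly n) :
    ‖ρ.trace (P * Q)‖ ≤ ‖ρ.emb P‖ * ‖ρ.emb Q‖ := by
  have h := ρ.inner_emb P.adjoint Q
  rw [adjoint_adjoint] at h
  rw [← h, ← ρ.norm_emb_adjoint P]
  exact norm_inner_le_norm _ _

/-- The conjugate relation `(τ ⊗ τ)(∂_j P) = τ(ξ P)` for the vector `ξ`. -/
def IsConjugateVariable (j : Fin n) (ξ : K) : Prop :=
  ∀ P, ρ.trace (leftDeriv j ρ.trace P) = ⟪ρ.emb P.adjoint, ξ⟫_ℂ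

/-- The vector `P ξ - (id ⊗ τ)(∂_j P)`; if `ξ` is the `j`-th conjugate variable, this is the value
of the adjoint of `∂_j` at `P ⊗ 1`. -/
noncomputable def derivAdjoint (j : Fin n) (ξ : K) (P : NCPoly n) : K :=
  ρ.rep P ξ - ρ.emb (rightDeriv j ρ.trace P)

variable {ρ} {j : Fin n} {ξ : K}

theorem adjoint_rightDeriv_trace (P : NCPoly n) :
    (rightDeriv j ρ.trace P).adjoint = leftDeriv j ρ.trace P.adjoint := by
  rw [adjoint_rightDeriv, conjFunctional_trace]

theorem IsConjugateVariable.inner_eq (hξ : ρ.IsConjugateVariable j ξ) (P : NCPoly n) :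
    ⟪ρ.emb P, ξ⟫_ℂ = ρ.trace (leftDeriv j ρ.trace P.adjoint) := by
  rw [hξ, adjoint_adjoint]

/-- The vector `ξ` is self-adjoint, in the sense that it may be moved to the other side. -/
theorem IsConjugateVariable.inner_eq' (hξ : ρ.IsConjugateVariable j ξ) (P : NCPoly n) :
    ⟪ξ, ρ.emb P⟫_ℂ = ρ.trace (leftDeriv j ρ.trace P) := by
  rw [← inner_conj_symm, hξ.inner_eq, ← trace_adjoint, ← adjoint_rightDeriv_trace,
    adjoint_adjoint, apply_leftDeriv]

/-- `⟨∂^*(P ⊗ 1), ∂^*(P ⊗ 1)⟩ = ⟨ξ, ∂^*(P^* P ⊗ 1)⟩`. All inner products with `ξ` are turned into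
traces of derivatives; what remains is coassociativity. -/
theorem IsConjugateVariable.inner_derivAdjoint_self (hξ : ρ.IsConjugateVariable j ξ)
    (P : NCPoly n) :
    ⟪ρ.derivAdjoint j ξ P, ρ.derivAdjoint j ξ P⟫_ℂ =
      ⟪ξ, ρ.derivAdjoint j ξ (P.adjoint * P)⟫_ℂ := by
  set E := rightDeriv j ρ.trace P with hE
  -- coassociativity enters here
  have h1 : ρ.trace (leftDeriv j ρ.trace (rightDeriv j (mulRightArg ρ.trace P) P.adjoint)) =
      ρ.trace (leftDeriv j ρ.trace E.adjoint * P) := by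
    rw [leftDeriv_rightDeriv, ← apply_leftDeriv, adjoint_rightDeriv_trace]
    rfl
  have h2 : ⟪ρ.emb E, ρ.rep P ξ⟫_ℂ =
      ρ.trace (leftDeriv j ρ.trace E.adjoint * P) + ρ.trace (E.adjoint * E) := by
    have : ⟪ρ.emb E, ρ.rep P ξ⟫_ℂ = ⟪ρ.emb (P.adjoint * E), ξ⟫_ℂ := by
      rw [emb_mul, inner_rep_left, adjoint_adjoint]
    rw [this, hξ.inner_eq, adjoint_mul, adjoint_adjoint, leftDeriv_mul, map_add, apply_leftDeriv
      (P := P), mulLeftArg_apply]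
  have h3 : ⟪ρ.rep P ξ, ρ.emb E⟫_ℂ = ⟪ξ, ρ.emb (P.adjoint * E)⟫_ℂ := by
    rw [inner_rep_left, emb_mul]
  have h4 : ⟪ρ.rep P ξ, ρ.rep P ξ⟫_ℂ = ⟪ξ, ρ.rep (P.adjoint * P) ξ⟫_ℂ := by
    rw [inner_rep_left, map_mul]; rfl
  rw [derivAdjoint, derivAdjoint, rightDeriv_mul, map_add, ← hE, inner_sub_left, inner_sub_right,
    inner_sub_right, inner_sub_right, inner_add_right, h2, h3, h4, inner_emb,
    hξ.inner_eq' (rightDeriv j _ _), h1]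
  ring

theorem IsConjugateVariable.norm_derivAdjoint_sq_le (hξ : ρ.IsConjugateVariable j ξ)
    (P : NCPoly n) :
    ‖ρ.derivAdjoint j ξ P‖ ^ 2 ≤ ‖ξ‖ * ‖ρ.derivAdjoint j ξ (P.adjoint * P)‖ := by
  have h := hξ.inner_derivAdjoint_self P
  calc ‖ρ.derivAdjoint j ξ P‖ ^ 2
      = ‖⟪ρ.derivAdjoint j ξ P, ρ.derivAdjoint j ξ P⟫_ℂ‖ := by
        rw [inner_self_eq_norm_sq_to_K]; simp
    _ ≤ _ := by rw [h]; exact norm_inner_le_norm _ _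

variable (ρ) in
theorem exists_norm_rightSlice_le (t : NCPoly n ⊗[ℂ] NCPoly n) :
    ∃ C, 0 ≤ C ∧ ∀ Q, ‖ρ.rep Q‖ ≤ 1 → ‖ρ.emb (rightSlice (mulRightArg ρ.trace Q) t)‖ ≤ C := by
  induction t using TensorProduct.induction_on with
  | zero => exact ⟨0, le_rfl, fun Q _ => by simp⟩
  | tmul a b =>
    refine ⟨‖ρ.emb b‖ * ‖ρ.vec‖ * ‖ρ.emb a‖, by positivity, fun Q hQ => ?_⟩
    rw [rightSlice_tmul, map_smul, norm_smul, mulRightArg_apply]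
    have h1 : ‖ρ.emb Q‖ ≤ ‖ρ.vec‖ := (ρ.rep Q).le_of_opNorm_le hQ ρ.vec |>.trans_eq (one_mul _)
    have h2 := ρ.norm_trace_mul_le b Q
    gcongr
    exact h2.trans (by gcongr)
  | add s t hs ht =>
    obtain ⟨C, hC, hs⟩ := hs
    obtain ⟨D, hD, ht⟩ := ht
    refine ⟨C + D, by positivity, fun Q hQ => ?_⟩
    rw [map_add, map_add]
    exact (norm_add_le _ _).trans (add_le_add (hs Q hQ) (ht Q hQ))

theorem norm_rep_pow_le_one {P : NCPoly n} (hP : ‖ρ.rep P‖ ≤ 1) (m : ℕ) :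
    ‖ρ.rep (P ^ m)‖ ≤ 1 := by
  induction m with
  | zero => rw [pow_zero, map_one]; exact ContinuousLinearMap.norm_id_le
  | succ m ih =>
    rw [pow_succ, map_mul]
    exact (norm_mul_le _ _).trans (mul_le_one₀ ih (norm_nonneg _) hP)

/-- A bound for the powers of a contraction that is linear in the exponent. -/
theorem exists_norm_derivAdjoint_pow_le (j : Fin n) (ξ : K) {P : NCPoly n}
    (hP : ‖ρ.rep P‖ ≤ 1) :
    ∃ C, ∀ m : ℕ, ‖ρ.derivAdjoint j ξ (P ^ m)‖ ≤ ‖ξ‖ + m * C := by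
  obtain ⟨C, hC, hbound⟩ := ρ.exists_norm_rightSlice_le (pderiv j P)
  refine ⟨C, fun m => ?_⟩
  have hE : ‖ρ.emb (rightDeriv j ρ.trace (P ^ m))‖ ≤ m * C := by
    induction m with
    | zero => simp [rightDeriv_one]
    | succ m ih =>
      rw [pow_succ', rightDeriv_mul, map_add]
      have h1 := hbound _ (norm_rep_pow_le_one hP m)
      have h2 := ρ.norm_emb_mul_le_rep_mul P (rightDeriv j ρ.trace (P ^ m))
      have h3 := mul_le_of_le_one_left (norm_nonneg (ρ.emb (rightDeriv j ρ.trace (P ^ m)))) hP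
      refine (norm_add_le _ _).trans ?_
      rw [rightDeriv, LinearMap.comp_apply]
      push_cast
      linarith
  have h1 : ‖ρ.rep (P ^ m) ξ‖ ≤ ‖ξ‖ :=
    ((ρ.rep (P ^ m)).le_of_opNorm_le (norm_rep_pow_le_one hP m) ξ).trans_eq (one_mul _)
  exact (norm_sub_le _ _).trans (add_le_add h1 hE)

/-- Iterating `‖∂^*(P ⊗ 1)‖² ≤ ‖ξ‖ ‖∂^*(P^* P ⊗ 1)‖` along the powers `(P^* P)^(2^k)` removes the
dependence on the derivative of `P`. -/
theorem IsConjugateVariable.norm_derivAdjoint_le (hξ : ρ.IsConjugateVariable j ξ)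
    {P : NCPoly n} (hP : ‖ρ.rep P‖ ≤ 1) : ‖ρ.derivAdjoint j ξ P‖ ≤ ‖ξ‖ := by
  rcases (norm_nonneg ξ).eq_or_lt with h0 | hpos
  · have := hξ.norm_derivAdjoint_sq_le P
    rw [← h0, zero_mul] at this
    rw [← h0]
    nlinarith [norm_nonneg (ρ.derivAdjoint j ξ P)]
  set S := P.adjoint * P with hS
  have hSadj : S.adjoint = S := by rw [hS, adjoint_mul, adjoint_adjoint]
  have hS1 : ‖ρ.rep S‖ ≤ 1 := by
    rw [hS, map_mul]
    refine (norm_mul_le _ _).trans ?_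
    rw [norm_rep_adjoint]
    exact mul_le_one₀ hP (norm_nonneg _) hP
  obtain ⟨C, hC⟩ := exists_norm_derivAdjoint_pow_le j ξ hS1
  have key : ‖ρ.derivAdjoint j ξ (S ^ 2 ^ 0)‖ / ‖ξ‖ ≤ 1 := by
    refine le_one_of_sq_le_succ (x := fun k => ‖ρ.derivAdjoint j ξ (S ^ 2 ^ k)‖ / ‖ξ‖)
      (A := 1) (B := C / ‖ξ‖) (fun k => by positivity) (fun k => ?_) fun k => ?_
    · have := hξ.norm_derivAdjoint_sq_le (S ^ 2 ^ k)
      rw [adjoint_pow, hSadj, ← pow_add, ← two_mul, ← pow_succ'] at this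
      rw [div_pow, div_le_div_iff₀ (by positivity) hpos]
      nlinarith
    · have := hC (2 ^ k)
      rw [div_le_iff₀ hpos, add_mul, one_mul, mul_assoc, div_mul_cancel₀ _ hpos.ne']
      exact_mod_cast this
  rw [pow_zero, pow_one, div_le_one hpos] at key
  have := hξ.norm_derivAdjoint_sq_le P
  nlinarith [norm_nonneg (ρ.derivAdjoint j ξ P)]

theorem IsConjugateVariable.norm_emb_rightDeriv_le_of_contraction
    (hξ : ρ.IsConjugateVariable j ξ) {P : NCPoly n} (hP : ‖ρ.rep P‖ ≤ 1) :
    ‖ρ.emb (rightDeriv j ρ.trace P)‖ ≤ 2 * ‖ξ‖ := by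
  have h1 := hξ.norm_derivAdjoint_le hP
  have h2 : ‖ρ.rep P ξ‖ ≤ ‖ξ‖ := ((ρ.rep P).le_of_opNorm_le hP ξ).trans_eq (one_mul _)
  have h3 : ρ.emb (rightDeriv j ρ.trace P) = ρ.rep P ξ - ρ.derivAdjoint j ξ P := by
    rw [derivAdjoint, sub_sub_cancel]
  rw [h3]
  linarith [norm_sub_le (ρ.rep P ξ) (ρ.derivAdjoint j ξ P)]

/-- Dabrowski's inequality: `‖(id ⊗ τ)(∂_j P)‖₂ ≤ 2 ‖ξ‖₂ ‖P‖`. -/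
theorem IsConjugateVariable.norm_emb_rightDeriv_le (hξ : ρ.IsConjugateVariable j ξ)
    {P : NCPoly n} {C : ℝ} (hC : 0 < C) (hP : ‖ρ.rep P‖ ≤ C) :
    ‖ρ.emb (rightDeriv j ρ.trace P)‖ ≤ 2 * ‖ξ‖ * C := by
  have hn : ‖((C : ℂ))⁻¹‖ = C⁻¹ := by rw [norm_inv, Complex.norm_real, Real.norm_of_nonneg hC.le]
  have h := hξ.norm_emb_rightDeriv_le_of_contraction (P := (C : ℂ)⁻¹ • P) (by
    rw [map_smul, norm_smul, hn, inv_mul_le_iff₀ hC, mul_one]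
    exact hP)
  rw [map_smul, map_smul, norm_smul, hn, inv_mul_le_iff₀ hC] at h
  linarith

theorem IsConjugateVariable.norm_emb_leftDeriv_le (hξ : ρ.IsConjugateVariable j ξ)
    {P : NCPoly n} {C : ℝ} (hC : 0 < C) (hP : ‖ρ.rep P‖ ≤ C) :
    ‖ρ.emb (leftDeriv j ρ.trace P)‖ ≤ 2 * ‖ξ‖ * C := by
  have h := hξ.norm_emb_rightDeriv_le hC (P := P.adjoint) (by rwa [norm_rep_adjoint])
  rwa [← norm_emb_adjoint, adjoint_rightDeriv_trace, adjoint_adjoint] at h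

/-- If `Q u` and `v Q` are small in the `2`-norm, then so is `(v ⊗ 1) (∂_j Q) (1 ⊗ u)`, tested
against `τ ⊗ τ(· c)`. -/
theorem IsConjugateVariable.norm_trace_leftDeriv_mul_le (hξ : ρ.IsConjugateVariable j ξ)
    {Q u v c : NCPoly n} {C : ℝ} (hu : ‖ρ.rep u‖ ≤ 1) (hv : ‖ρ.rep v‖ ≤ 1) (hC : 0 < C)
    (hc : ‖ρ.rep c‖ ≤ C) :
    ‖ρ.trace (leftDeriv j (mulLeftArg ρ.trace v) Q * (u * c))‖ ≤
      3 * ‖ξ‖ * C * (‖ρ.emb (Q * u)‖ + ‖ρ.emb (v * Q)‖) := by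
  have huc : ‖ρ.rep (u * c)‖ ≤ C := by
    rw [map_mul]
    refine (norm_mul_le _ _).trans ?_
    calc _ ≤ 1 * C := by gcongr
      _ = C := one_mul C
  have hQuc : ‖ρ.emb (Q * (u * c))‖ ≤ ‖ρ.emb (Q * u)‖ * C := by
    rw [← mul_assoc]
    exact (ρ.norm_emb_mul_le_mul_rep _ _).trans (by gcongr)
  have hvQuc : ‖ρ.emb (v * (Q * (u * c)))‖ ≤ ‖ρ.emb (Q * u)‖ * C := by
    refine (ρ.norm_emb_mul_le_rep_mul _ _).trans ?_
    calc _ ≤ 1 * (‖ρ.emb (Q * u)‖ * C) := by gcongr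
      _ = _ := one_mul _
  have hmul : mulLeftArg (mulLeftArg ρ.trace v) Q = mulLeftArg ρ.trace (v * Q) := by
    refine LinearMap.ext fun P => ?_
    simp only [mulLeftArg_apply, mul_assoc]
  -- Leibniz rule for the product `v Q (u c)`
  have hid : ρ.trace (leftDeriv j (mulLeftArg ρ.trace v) Q * (u * c)) =
      ρ.trace (leftDeriv j ρ.trace (v * (Q * (u * c)))) -
        ρ.trace (leftDeriv j ρ.trace v * (Q * (u * c))) -
        ρ.trace (v * Q * rightDeriv j ρ.trace (u * c)) := by
    rw [leftDeriv_mul j _ v, leftDeriv_mul j _ Q, hmul, map_add, map_add,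
      apply_leftDeriv (P := u * c), mulLeftArg_apply]
    ring
  have t1 : ‖ρ.trace (leftDeriv j ρ.trace (v * (Q * (u * c))))‖ ≤ ‖ρ.emb (Q * u)‖ * C * ‖ξ‖ := by
    rw [hξ]
    refine (norm_inner_le_norm _ _).trans ?_
    rw [norm_emb_adjoint]
    gcongr
  have t2 : ‖ρ.trace (leftDeriv j ρ.trace v * (Q * (u * c)))‖ ≤
      2 * ‖ξ‖ * 1 * (‖ρ.emb (Q * u)‖ * C) := by
    refine (ρ.norm_trace_mul_le _ _).trans ?_
    have := hξ.norm_emb_leftDeriv_le one_pos hv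
    gcongr
  have t3 : ‖ρ.trace (v * Q * rightDeriv j ρ.trace (u * c))‖ ≤
      ‖ρ.emb (v * Q)‖ * (2 * ‖ξ‖ * C) := by
    refine (ρ.norm_trace_mul_le _ _).trans ?_
    have := hξ.norm_emb_rightDeriv_le hC huc
    gcongr
  have hnn : 0 ≤ ‖ρ.emb (v * Q)‖ * (‖ξ‖ * C) := by positivity
  rw [hid]
  refine (norm_sub_le _ _).trans ?_
  linarith [norm_sub_le (ρ.trace (leftDeriv j ρ.trace (v * (Q * (u * c)))))
    (ρ.trace (leftDeriv j ρ.trace v * (Q * (u * c))))]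

end TracialRep

end

/-! ### Approximate kernel projections -/

section

variable {n : ℕ} {K : Type*} [NormedAddCommGroup K] [InnerProductSpace ℂ K] [CompleteSpace K]

namespace NCPoly

/-- The polynomial `1 - x^* x`. When `x` acts as a contraction, its powers approximate the
projection onto the kernel of `x`. -/
noncomputable def defect (x : NCPoly n) : NCPoly n := 1 - x.adjoint * x

theorem adjoint_defect (x : NCPoly n) : x.defect.adjoint = x.defect := by
  rw [defect, adjoint_sub, adjoint_one, adjoint_mul, adjoint_adjoint]

theorem adjoint_defect_pow (x : NCPoly n) (k : ℕ) : (x.defect ^ k).adjoint = x.defect ^ k := by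
  rw [adjoint_pow, adjoint_defect]

theorem mul_defect_pow (x : NCPoly n) (k : ℕ) :
    x * x.defect ^ k = x.adjoint.defect ^ k * x := by
  have h : SemiconjBy x x.defect x.adjoint.defect := by
    rw [SemiconjBy, defect, defect, adjoint_adjoint]
    noncomm_ring
  exact h.pow_right k

end NCPoly

namespace TracialRep

open NCPoly Filter Topology

variable {ρ : TracialRep n K} {x : NCPoly n}

theorem norm_rep_defect_apply_sq_le (hx : ‖ρ.rep x‖ ≤ 1) (y : K) :
    ‖ρ.rep x.defect y‖ ^ 2 ≤ ‖y‖ ^ 2 - ‖ρ.rep x y‖ ^ 2 := by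
  have h1 : ρ.rep x.defect y = y - ρ.rep x.adjoint (ρ.rep x y) := by
    rw [defect, map_sub, map_one, map_mul]; rfl
  have h2 : ‖ρ.rep x.adjoint (ρ.rep x y)‖ ≤ ‖ρ.rep x y‖ :=
    ((ρ.rep x.adjoint).le_of_opNorm_le (by rwa [norm_rep_adjoint]) _).trans_eq (one_mul _)
  have h3 : ⟪y, ρ.rep x.adjoint (ρ.rep x y)⟫_ℂ = ((‖ρ.rep x y‖ ^ 2 : ℝ) : ℂ) := by
    rw [← inner_rep_left, inner_self_eq_norm_sq_to_K]
    push_cast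
    rfl
  have h4 : RCLike.re ⟪y, ρ.rep x.adjoint (ρ.rep x y)⟫_ℂ = ‖ρ.rep x y‖ ^ 2 := by
    rw [h3]; exact Complex.ofReal_re _
  rw [h1, norm_sub_sq (𝕜 := ℂ), h4]
  have := pow_le_pow_left₀ (norm_nonneg _) h2 2
  linarith

theorem norm_rep_defect_le_one (hx : ‖ρ.rep x‖ ≤ 1) : ‖ρ.rep x.defect‖ ≤ 1 := by
  refine ContinuousLinearMap.opNorm_le_bound _ zero_le_one fun y => ?_
  rw [one_mul]
  refine le_of_sq_le_sq ?_ (norm_nonneg y)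
  exact (norm_rep_defect_apply_sq_le hx y).trans (sub_le_self _ (by positivity))

theorem norm_rep_defect_pow_le_one (hx : ‖ρ.rep x‖ ≤ 1) (k : ℕ) : ‖ρ.rep (x.defect ^ k)‖ ≤ 1 :=
  norm_rep_pow_le_one (norm_rep_defect_le_one hx) k

/-- The squared norms telescope: `‖x (1 - x^* x)^k Ω‖² ≤ ‖(1 - x^* x)^k Ω‖² - ‖(1 - x^* x)^(k+1) Ω‖²`.
-/
theorem tendsto_norm_emb_mul_defect_pow (hx : ‖ρ.rep x‖ ≤ 1) :
    Tendsto (fun k : ℕ => ‖ρ.emb (x * x.defect ^ k)‖) atTop (𝓝 0) := by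
  set a : ℕ → ℝ := fun k => ‖ρ.emb (x.defect ^ k)‖ ^ 2 with ha
  have hstep : ∀ k, ‖ρ.emb (x * x.defect ^ k)‖ ^ 2 ≤ a k - a (k + 1) := by
    intro k
    have := norm_rep_defect_apply_sq_le hx (ρ.emb (x.defect ^ k))
    rw [← emb_mul, ← emb_mul, ← pow_succ'] at this
    linarith
  have hanti : Antitone a := antitone_nat_of_succ_le fun k => by
    have := hstep k
    nlinarith [sq_nonneg ‖ρ.emb (x * x.defect ^ k)‖]
  have hlim := tendsto_atTop_ciInf hanti ⟨0, by rintro _ ⟨k, rfl⟩; positivity⟩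
  have hdiff := hlim.sub (hlim.comp (tendsto_add_atTop_nat 1))
  rw [sub_self] at hdiff
  have hsq := squeeze_zero (fun k => by positivity) hstep hdiff
  have := hsq.sqrt
  simpa using this

/-- The kernel projections of `x` and of `x^*` have the same trace, at the level of their
approximations. -/
theorem trace_defect_pow (x : NCPoly n) (k : ℕ) :
    ρ.trace (x.defect ^ k) = ρ.trace (x.adjoint.defect ^ k) := by
  induction k with
  | zero => simp
  | succ k ih =>
    have h1 : x.defect ^ (k + 1) = x.defect ^ k - x.adjoint * (x * x.defect ^ k) := by
      rw [pow_succ', defect, sub_mul, one_mul, mul_assoc]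
    have h2 : x.adjoint.defect ^ (k + 1) =
        x.adjoint.defect ^ k - x.adjoint.defect ^ k * x * x.adjoint := by
      conv_lhs => rw [pow_succ]
      conv_lhs => enter [2]; rw [defect, adjoint_adjoint]
      rw [mul_sub, mul_one, mul_assoc]
    rw [h1, h2, map_sub, map_sub, ih, mul_defect_pow, ρ.trace_mul_comm x.adjoint]

theorem trace_defect_pow_two_mul (x : NCPoly n) (k : ℕ) :
    ρ.trace (x.defect ^ (2 * k)) = ((‖ρ.emb (x.defect ^ k)‖ ^ 2 : ℝ) : ℂ) := by
  rw [← trace_adjoint_mul_self, adjoint_defect_pow, ← pow_add, two_mul]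

theorem norm_emb_defect_pow_adjoint (x : NCPoly n) (k : ℕ) :
    ‖ρ.emb (x.adjoint.defect ^ k)‖ = ‖ρ.emb (x.defect ^ k)‖ := by
  have h := ρ.trace_defect_pow x (2 * k)
  rw [trace_defect_pow_two_mul, trace_defect_pow_two_mul] at h
  exact (pow_left_inj₀ (norm_nonneg _) (norm_nonneg _) two_ne_zero).1 (by exact_mod_cast h.symm)

/-- If `x u` is small, then `u` is almost fixed by the powers of `1 - x^* x`. -/
theorem norm_emb_le_add_defect_pow (hx : ‖ρ.rep x‖ ≤ 1) (u : NCPoly n) (k : ℕ) :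
    ‖ρ.emb u‖ ≤ ‖ρ.emb (x.defect ^ k * u)‖ + k * ‖ρ.emb (x * u)‖ := by
  induction k with
  | zero => simp
  | succ k ih =>
    have h1 : x.defect ^ k * u =
        x.defect ^ (k + 1) * u + x.defect ^ k * (x.adjoint * (x * u)) := by
      rw [pow_succ, mul_assoc, ← mul_add]
      congr 1
      rw [defect]
      noncomm_ring
    have h2 : ‖ρ.emb (x.defect ^ k * (x.adjoint * (x * u)))‖ ≤ ‖ρ.emb (x * u)‖ := by
      refine (ρ.norm_emb_mul_le_rep_mul _ _).trans ?_
      refine (mul_le_of_le_one_left (norm_nonneg _) (norm_rep_defect_pow_le_one hx k)).trans ?_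
      refine (ρ.norm_emb_mul_le_rep_mul _ _).trans ?_
      exact mul_le_of_le_one_left (norm_nonneg _) (by rwa [norm_rep_adjoint])
    have h3 : ‖ρ.emb (x.defect ^ k * u)‖ ≤
        ‖ρ.emb (x.defect ^ (k + 1) * u)‖ + ‖ρ.emb (x.defect ^ k * (x.adjoint * (x * u)))‖ := by
      conv_lhs => rw [h1, map_add]
      exact norm_add_le _ _
    push_cast
    linarith

/-! ### Absence of zero divisors -/

variable (ρ) in
theorem norm_emb_le_of_contraction {P : NCPoly n} (hP : ‖ρ.rep P‖ ≤ 1) :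
    ‖ρ.emb P‖ ≤ ‖ρ.vec‖ :=
  ((ρ.rep P).le_of_opNorm_le hP ρ.vec).trans_eq (one_mul _)

/-- Weak limits along an ultrafilter of the functionals `τ(V_k ·)` for contractions `V_k`. -/
theorem exists_tendsto_trace_mul (F : Ultrafilter ℕ) {V : ℕ → NCPoly n}
    (hV : ∀ k, ‖ρ.rep (V k)‖ ≤ 1) :
    ∃ ψ : NCPoly n →ₗ[ℂ] ℂ, ∀ P, Tendsto (fun k => mulLeftArg ρ.trace (V k) P) F (𝓝 (ψ P)) := by
  have hlim : ∀ P, ∃ z, Tendsto (fun k => mulLeftArg ρ.trace (V k) P) F (𝓝 z) := by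
    intro P
    have hmem : ∀ k, mulLeftArg ρ.trace (V k) P ∈
        Metric.closedBall (0 : ℂ) (‖ρ.vec‖ * ‖ρ.emb P‖) := by
      intro k
      rw [mem_closedBall_zero_iff, mulLeftArg_apply]
      refine (ρ.norm_trace_mul_le _ _).trans ?_
      have := ρ.norm_emb_le_of_contraction (hV k)
      gcongr
    obtain ⟨z, -, hz⟩ := (isCompact_closedBall (0 : ℂ) (‖ρ.vec‖ * ‖ρ.emb P‖)).ultrafilter_le_nhds
      (F.map fun k => mulLeftArg ρ.trace (V k) P)
      (le_principal_iff.2 (Eventually.of_forall (f := (F : Filter ℕ)) hmem))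
    exact ⟨z, hz⟩
  choose f hf using hlim
  refine ⟨{ toFun := f, map_add' := fun P Q => ?_, map_smul' := fun c P => ?_ }, hf⟩
  · refine tendsto_nhds_unique (hf (P + Q)) ?_
    simpa only [map_add] using (hf P).add (hf Q)
  · refine tendsto_nhds_unique (hf (c • P)) ?_
    simpa only [map_smul, RingHom.id_apply, smul_eq_mul] using (hf P).const_mul c

theorem tendsto_emb_leftDeriv {F : Filter ℕ} {φ : ℕ → NCPoly n →ₗ[ℂ] ℂ} {ψ : NCPoly n →ₗ[ℂ] ℂ}
    (h : ∀ P, Tendsto (fun k => φ k P) F (𝓝 (ψ P))) (j : Fin n) (Q : NCPoly n) :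
    Tendsto (fun k => ρ.emb (leftDeriv j (φ k) Q)) F (𝓝 (ρ.emb (leftDeriv j ψ Q))) := by
  simp only [leftDeriv, LinearMap.comp_apply]
  induction pderiv j Q using TensorProduct.induction_on with
  | zero => simpa only [map_zero] using tendsto_const_nhds
  | tmul a b => simpa only [leftSlice_tmul, map_smul] using (h a).smul_const _
  | add s t hs ht => simpa only [map_add] using hs.add ht

/-- The step that lowers the degree: if `Q u_k → 0` and `V_k Q → 0` in the `2`-norm, and `ψ` is the
limit of the functionals `τ(V_k ·)`, then `(ψ ⊗ id)(∂_j Q) u_k → 0` in the `2`-norm. -/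
theorem IsConjugateVariable.tendsto_emb_leftDeriv_mul {j : Fin n} {ξ : K}
    (hξ : ρ.IsConjugateVariable j ξ) {F : Filter ℕ} {Q : NCPoly n} {u V : ℕ → NCPoly n}
    (hu : ∀ k, ‖ρ.rep (u k)‖ ≤ 1) (hV : ∀ k, ‖ρ.rep (V k)‖ ≤ 1)
    (hQu : Tendsto (fun k => ‖ρ.emb (Q * u k)‖) F (𝓝 0))
    (hVQ : Tendsto (fun k => ‖ρ.emb (V k * Q)‖) F (𝓝 0)) {ψ : NCPoly n →ₗ[ℂ] ℂ}
    (hψ : ∀ P, Tendsto (fun k => mulLeftArg ρ.trace (V k) P) F (𝓝 (ψ P))) :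
    Tendsto (fun k => ‖ρ.emb (leftDeriv j ψ Q * u k)‖) F (𝓝 0) := by
  set D := leftDeriv j ψ Q with hD
  set Dk : ℕ → NCPoly n := fun k => leftDeriv j (mulLeftArg ρ.trace (V k)) Q with hDk
  set C := ‖ρ.rep D‖ + 1 with hC
  have hC0 : 0 < C := by positivity
  have hlimD : Tendsto (fun k => ‖ρ.emb (D - Dk k)‖) F (𝓝 0) := by
    have := (tendsto_const_nhds (x := ρ.emb D)).sub (tendsto_emb_leftDeriv (ρ := ρ) hψ j Q)
    rw [← hD, sub_self] at this
    simpa only [map_sub, norm_zero] using this.norm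
  have hbound : ∀ k, ‖ρ.emb (D * u k)‖ ^ 2 ≤ ‖ρ.emb (D - Dk k)‖ * (C * ‖ρ.vec‖) +
      3 * ‖ξ‖ * C * (‖ρ.emb (Q * u k)‖ + ‖ρ.emb (V k * Q)‖) := by
    intro k
    set c := (D * u k).adjoint with hc
    have hcC : ‖ρ.rep c‖ ≤ C := by
      rw [hc, norm_rep_adjoint, map_mul]
      refine (norm_mul_le _ _).trans ((mul_le_of_le_one_right (norm_nonneg _) (hu k)).trans ?_)
      rw [hC]; linarith
    have huc : ‖ρ.emb (u k * c)‖ ≤ C * ‖ρ.vec‖ := by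
      refine (ρ.norm_emb_mul_le_rep_mul _ _).trans ?_
      refine (mul_le_of_le_one_left (norm_nonneg _) (hu k)).trans ?_
      exact (ρ.rep c).le_of_opNorm_le hcC _
    have hsq : ((‖ρ.emb (D * u k)‖ ^ 2 : ℝ) : ℂ) =
        ρ.trace ((D - Dk k) * (u k * c)) + ρ.trace (Dk k * (u k * c)) := by
      rw [← map_add, ← add_mul, sub_add_cancel, ← mul_assoc, ρ.trace_mul_comm,
        trace_adjoint_mul_self]
    have hnorm : ‖ρ.emb (D * u k)‖ ^ 2 =
        ‖ρ.trace ((D - Dk k) * (u k * c)) + ρ.trace (Dk k * (u k * c))‖ := by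
      rw [← hsq, Complex.norm_real, Real.norm_of_nonneg (by positivity)]
    rw [hnorm]
    refine (norm_add_le _ _).trans (add_le_add ?_ ?_)
    · exact (ρ.norm_trace_mul_le _ _).trans (by gcongr)
    · exact hξ.norm_trace_leftDeriv_mul_le (hu k) (hV k) hC0 hcC
  have hlim : Tendsto (fun k => ‖ρ.emb (D - Dk k)‖ * (C * ‖ρ.vec‖) +
      3 * ‖ξ‖ * C * (‖ρ.emb (Q * u k)‖ + ‖ρ.emb (V k * Q)‖)) F (𝓝 0) := by
    simpa using (hlimD.mul_const (C * ‖ρ.vec‖)).add ((hQu.add hVQ).const_mul (3 * ‖ξ‖ * C))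
  simpa using (squeeze_zero (fun k => by positivity) hbound hlim).sqrt

/-- If all conjugate variables exist, a nonzero polynomial `Q` is not a left zero divisor, even
approximately: `Q u_k → 0` in the `2`-norm for contractions `u_k` forces `u_k → 0`. -/
theorem tendsto_emb_zero_of_mul (hξ : ∀ j, ∃ ξ, ρ.IsConjugateVariable j ξ) {F : Ultrafilter ℕ}
    (hF : (F : Filter ℕ) ≤ atTop) {u : ℕ → NCPoly n} (hu : ∀ k, ‖ρ.rep (u k)‖ ≤ 1) (d : ℕ)
    {Q : NCPoly n} (hQ0 : Q ≠ 0) (hQd : DegreeLE d Q)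
    (hQu : Tendsto (fun k => ‖ρ.emb (Q * u k)‖) F (𝓝 0)) :
    Tendsto (fun k => ‖ρ.emb (u k)‖) F (𝓝 0) := by
  induction d generalizing Q with
  | zero =>
    have hQ := hQd.eq_smul_one
    set c := Q.coeff 1
    have hc : c ≠ 0 := by
      intro hc
      rw [hc, zero_smul] at hQ
      exact hQ0 hQ
    rw [hQ] at hQu
    simp only [smul_mul_assoc, one_mul, map_smul, norm_smul] at hQu
    have := hQu.const_mul ‖c‖⁻¹
    simpa only [inv_mul_cancel_left₀ (norm_ne_zero_iff.2 hc), mul_zero] using this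
  | succ d ih =>
    by_cases hQd' : DegreeLE d Q
    · exact ih hQ0 hQd' hQu
    obtain ⟨j, hj⟩ := hQd.exists_leftDeriv_ne_zero hQd'
    obtain ⟨ξ, hξj⟩ := hξ j
    by_contra hcon
    obtain ⟨ε, hε, hev⟩ : ∃ ε > 0, ∀ᶠ k in (F : Filter ℕ), ε ≤ ‖ρ.emb (u k)‖ := by
      rw [Metric.tendsto_nhds] at hcon
      push Not at hcon
      obtain ⟨ε, hε, h⟩ := hcon
      refine ⟨ε, hε, ?_⟩
      filter_upwards [h] with k hk
      simpa using hk
    -- a multiple of `Q` that acts as a contraction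
    set c : ℂ := (((‖ρ.rep Q‖ + 1)⁻¹ : ℝ) : ℂ) with hc
    set x := c • Q with hx
    have hnc : ‖c‖ = (‖ρ.rep Q‖ + 1)⁻¹ := by
      rw [hc, Complex.norm_real, Real.norm_of_nonneg (by positivity)]
    have hc0 : ‖c‖ ≠ 0 := by rw [hnc]; positivity
    have hx1 : ‖ρ.rep x‖ ≤ 1 := by
      rw [hx, map_smul, norm_smul, hnc, inv_mul_le_iff₀ (by positivity)]
      linarith
    have hx1' : ‖ρ.rep x.adjoint‖ ≤ 1 := by rwa [norm_rep_adjoint]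
    -- the approximate kernel projections of `x`, hence those of `x^*`, stay away from zero
    have hlow : ∀ m, ε ≤ ‖ρ.emb (x.adjoint.defect ^ m)‖ := by
      intro m
      rw [norm_emb_defect_pow_adjoint]
      have hlim : Tendsto (fun k => ‖ρ.emb (x.defect ^ m)‖ + m * (‖c‖ * ‖ρ.emb (Q * u k)‖)) F
          (𝓝 (‖ρ.emb (x.defect ^ m)‖ + m * (‖c‖ * 0))) :=
        tendsto_const_nhds.add ((hQu.const_mul _).const_mul _)
      rw [mul_zero, mul_zero, add_zero] at hlim
      refine ge_of_tendsto hlim ?_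
      filter_upwards [hev] with k hk
      refine hk.trans ((norm_emb_le_add_defect_pow hx1 (u k) m).trans ?_)
      have h1 : ‖ρ.emb (x.defect ^ m * u k)‖ ≤ ‖ρ.emb (x.defect ^ m)‖ :=
        (ρ.norm_emb_mul_le_mul_rep _ _).trans (mul_le_of_le_one_right (norm_nonneg _) (hu k))
      rw [hx, smul_mul_assoc, map_smul, norm_smul, ← hx]
      linarith
    -- even exponents, so that the trace of `V k` is a squared `2`-norm
    set V : ℕ → NCPoly n := fun k => x.adjoint.defect ^ (2 * k) with hV
    have hV1 : ∀ k, ‖ρ.rep (V k)‖ ≤ 1 := fun k => norm_rep_defect_pow_le_one hx1' _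
    have hVQ : Tendsto (fun k => ‖ρ.emb (V k * Q)‖) F (𝓝 0) := by
      have h1 : ∀ k, ‖ρ.emb (V k * Q)‖ =
          ‖c‖⁻¹ * ‖ρ.emb (x.adjoint * x.adjoint.defect ^ (2 * k))‖ := by
        intro k
        rw [← norm_emb_adjoint (P := x.adjoint * _), adjoint_mul, adjoint_adjoint,
          adjoint_defect_pow, hx, mul_smul_comm, map_smul, norm_smul, inv_mul_cancel_left₀ hc0]
      simp only [h1]
      have h2 := (tendsto_norm_emb_mul_defect_pow hx1').comp
        (tendsto_id.const_mul_atTop' (r := 2) two_pos)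
      simpa using (h2.mono_left hF).const_mul ‖c‖⁻¹
    obtain ⟨ψ, hψ⟩ := exists_tendsto_trace_mul F hV1
    have hψ1 : ψ 1 ≠ 0 := by
      rw [← norm_pos_iff]
      refine (pow_pos hε 2).trans_le (ge_of_tendsto' (hψ 1).norm fun k => ?_)
      rw [mulLeftArg_apply, mul_one, hV, trace_defect_pow_two_mul, Complex.norm_real,
        Real.norm_of_nonneg (by positivity)]
      exact pow_le_pow_left₀ hε.le (hlow k) 2
    exact hcon (ih (hj ψ hψ1) (hQd.leftDeriv j ψ)
      (hξj.tendsto_emb_leftDeriv_mul hu hV1 hQu hVQ hψ))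

/-- The kernel projection of a nonzero polynomial vanishes. -/
theorem tendsto_emb_defect_pow (hξ : ∀ j, ∃ ξ, ρ.IsConjugateVariable j ξ) {F : Ultrafilter ℕ}
    (hF : (F : Filter ℕ) ≤ atTop) (hx0 : x ≠ 0) (hx : ‖ρ.rep x‖ ≤ 1) :
    Tendsto (fun k => ‖ρ.emb (x.defect ^ k)‖) F (𝓝 0) := by
  obtain ⟨d, hd⟩ := exists_degreeLE x
  exact tendsto_emb_zero_of_mul hξ hF (norm_rep_defect_pow_le_one hx) d hx0 hd
    ((tendsto_norm_emb_mul_defect_pow hx).mono_left hF)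

end TracialRep

end

/-! ### The left regular representation on `L²(M, τ)` -/

section

variable {H : Type*} [NormedAddCommGroup H] [InnerProductSpace ℂ H] [CompleteSpace H]

theorem VonNeumannAlgebra.isClosed_toStarSubalgebra (M : VonNeumannAlgebra H) :
    IsClosed (M.toStarSubalgebra : Set (H →L[ℂ] H)) := by
  rw [VonNeumannAlgebra.coe_toStarSubalgebra, ← M.centralizer_centralizer]
  exact Set.isClosed_centralizer _

/-- The square root of `‖a‖² - a^* a` lies in `M`. -/
theorem VonNeumannAlgebra.exists_star_mul_self_eq (M : VonNeumannAlgebra H)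
    (a : M.toStarSubalgebra) :
    ∃ c : M.toStarSubalgebra, star c * c = ((‖a‖ ^ 2 : ℝ) : ℂ) • 1 - star a * a := by
  set T : H →L[ℂ] H :=
    algebraMap ℝ (H →L[ℂ] H) (‖(a : H →L[ℂ] H)‖ ^ 2) - star (a : H →L[ℂ] H) * a with hT
  have hT0 : 0 ≤ T := sub_nonneg.2 CStarAlgebra.star_mul_le_algebraMap_norm_sq
  have hTsa : IsSelfAdjoint T := .of_nonneg hT0
  have hTeq : T = ((((‖a‖ ^ 2 : ℝ) : ℂ) • 1 - star a * a : M.toStarSubalgebra) : H →L[ℂ] H) := by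
    rw [hT, Algebra.algebraMap_eq_smul_one]
    rfl
  have hTM : T ∈ M.toStarSubalgebra := by rw [hTeq]; exact Subtype.property _
  have : IsClosed (M.toStarSubalgebra : Set (H →L[ℂ] H)) := M.isClosed_toStarSubalgebra
  refine ⟨⟨cfc Real.sqrt T, cfc_mem Real.sqrt hTM⟩, Subtype.ext ?_⟩
  rw [← hTeq]
  change star (cfc Real.sqrt T) * cfc Real.sqrt T = T
  have hsa : IsSelfAdjoint (cfc Real.sqrt T) := cfc_predicate _ _
  rw [hsa.star_eq, ← cfc_mul Real.sqrt Real.sqrt T]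
  conv_rhs => rw [← cfc_id' ℝ T]
  exact cfc_congr fun s hs => Real.mul_self_sqrt (spectrum_nonneg_of_nonneg hT0 hs)

namespace FaithfulNormalTracialState

variable {M : VonNeumannAlgebra H} (τ : FaithfulNormalTracialState M)

theorem norm_toL2_sq (a : M.toStarSubalgebra) :
    ((‖τ.toL2 a‖ ^ 2 : ℝ) : ℂ) = τ.toLinearMap (star a * a) := by
  rw [← inner_toL2, inner_self_eq_norm_sq_to_K]
  push_cast
  rfl

/-- Since `‖a‖² - a^* a = c^* c` with `c ∈ M`, positivity of `τ` gives `‖a b‖₂² ≤ ‖a‖² ‖b‖₂²`. -/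
theorem norm_toL2_mul_le (a b : M.toStarSubalgebra) :
    ‖τ.toL2 (a * b)‖ ≤ ‖a‖ * ‖τ.toL2 b‖ := by
  obtain ⟨c, hc⟩ := M.exists_star_mul_self_eq a
  have h : ((‖τ.toL2 (c * b)‖ ^ 2 : ℝ) : ℂ) =
      ((‖a‖ ^ 2 * ‖τ.toL2 b‖ ^ 2 - ‖τ.toL2 (a * b)‖ ^ 2 : ℝ) : ℂ) := by
    rw [Complex.ofReal_sub, Complex.ofReal_mul, norm_toL2_sq, norm_toL2_sq, norm_toL2_sq,
      ← smul_eq_mul (Complex.ofReal _), ← map_smul, ← map_sub]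
    congr 1
    rw [star_mul, star_mul, mul_assoc, ← mul_assoc (star c), hc, mul_assoc, ← mul_assoc (star a),
      sub_mul, mul_sub, smul_mul_assoc, one_mul, mul_smul_comm]
  have h' : ‖τ.toL2 (c * b)‖ ^ 2 = ‖a‖ ^ 2 * ‖τ.toL2 b‖ ^ 2 - ‖τ.toL2 (a * b)‖ ^ 2 :=
    Complex.ofReal_injective h
  refine le_of_sq_le_sq ?_ (by positivity)
  rw [mul_pow]
  linarith [sq_nonneg ‖τ.toL2 (c * b)‖]

theorem denseRange_toL2 : DenseRange τ.toL2 :=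
  UniformSpace.Completion.denseRange_coe (α := τ.PreL2)

/-- Left multiplication by `a ∈ M` on `L²(M, τ)`. -/
noncomputable def leftMul (a : M.toStarSubalgebra) : τ.L2 →L[ℂ] τ.L2 :=
  (LinearMap.mkContinuous
    (τ.toPreL2.toLinearMap ∘ₗ LinearMap.mulLeft ℂ a ∘ₗ τ.toPreL2.symm.toLinearMap) ‖a‖ (by
      intro b
      have := τ.norm_toL2_mul_le a (τ.toPreL2.symm b)
      have h1 (c : M.toStarSubalgebra) : ‖τ.toL2 c‖ = ‖τ.toPreL2 c‖ :=
        UniformSpace.Completion.norm_coe _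
      rwa [h1, h1, LinearEquiv.apply_symm_apply] at this)).completion

theorem leftMul_toL2 (a b : M.toStarSubalgebra) : τ.leftMul a (τ.toL2 b) = τ.toL2 (a * b) :=
  ContinuousLinearMap.completion_apply_coe _ _

theorem ext_toL2 {S T : τ.L2 →L[ℂ] τ.L2} (h : ∀ a, S (τ.toL2 a) = T (τ.toL2 a)) : S = T :=
  ContinuousLinearMap.ext fun x =>
    congrFun (τ.denseRange_toL2.equalizer S.continuous T.continuous (funext h)) x

/-- The left regular representation of `M` on `L²(M, τ)`. -/
noncomputable def leftMulHom : M.toStarSubalgebra →ₐ[ℂ] (τ.L2 →L[ℂ] τ.L2) :=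
  AlgHom.ofLinearMap
    { toFun := τ.leftMul
      map_add' := fun a b => τ.ext_toL2 fun c => by
        rw [add_apply, leftMul_toL2, leftMul_toL2, leftMul_toL2, add_mul, map_add]
      map_smul' := fun r a => τ.ext_toL2 fun c => by
        rw [RingHom.id_apply, smul_apply, leftMul_toL2, leftMul_toL2, smul_mul_assoc, map_smul] }
    (τ.ext_toL2 fun c => (τ.leftMul_toL2 1 c).trans (by rw [one_mul]; rfl))
    (fun a b => τ.ext_toL2 fun c => by
      change τ.leftMul (a * b) (τ.toL2 c) = τ.leftMul a (τ.leftMul b (τ.toL2 c))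
      rw [leftMul_toL2, leftMul_toL2, leftMul_toL2, mul_assoc])

theorem leftMulHom_toL2 (a b : M.toStarSubalgebra) :
    τ.leftMulHom a (τ.toL2 b) = τ.toL2 (a * b) := τ.leftMul_toL2 a b

theorem leftMulHom_star (a : M.toStarSubalgebra) :
    τ.leftMulHom (star a) = star (τ.leftMulHom a) := by
  refine τ.ext_toL2 fun b => ?_
  refine τ.denseRange_toL2.eq_of_inner_right ℂ fun c => ?_
  rw [ContinuousLinearMap.star_eq_adjoint, ContinuousLinearMap.adjoint_inner_right,
    leftMulHom_toL2, leftMulHom_toL2, inner_toL2, inner_toL2, star_mul, mul_assoc]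

theorem inner_toL2_one (a : M.toStarSubalgebra) :
    ⟪τ.toL2 1, τ.leftMulHom a (τ.toL2 1)⟫_ℂ = τ.toLinearMap a := by
  rw [leftMulHom_toL2, inner_toL2, star_one, one_mul, mul_one]

/-- The tracial representation of the non-commutative polynomials on `L²(M, τ)` given by
evaluation at a tuple of self-adjoint elements. -/
noncomputable def tracialRep {n : ℕ} (X : Fin n → M.toStarSubalgebra)
    (hX : ∀ j, IsSelfAdjoint (X j)) : TracialRep n τ.L2 where
  rep := τ.leftMulHom.comp (NCPoly.ev X)
  vec := τ.toL2 1
  rep_adjoint P := by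
    rw [AlgHom.comp_apply, NCPoly.ev_adjoint X hX, leftMulHom_star, AlgHom.comp_apply]
  tracial P Q := by
    rw [AlgHom.comp_apply, AlgHom.comp_apply, inner_toL2_one, inner_toL2_one,
      map_mul (NCPoly.ev X), map_mul (NCPoly.ev X), τ.tracial]

variable {n : ℕ} {X : Fin n → M.toStarSubalgebra} (hX : ∀ j, IsSelfAdjoint (X j))

theorem tracialRep_emb (P : NCPoly n) : (τ.tracialRep X hX).emb P = τ.toL2 (NCPoly.ev X P) := by
  change τ.leftMulHom (NCPoly.ev X P) (τ.toL2 1) = _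
  rw [leftMulHom_toL2, mul_one]

theorem tracialRep_trace (P : NCPoly n) :
    (τ.tracialRep X hX).trace P = τ.toLinearMap (NCPoly.ev X P) :=
  τ.inner_toL2_one _

variable {τ} in
theorem SatisfiesConjugateRelations.isConjugateVariable {ξ : Fin n → τ.L2}
    (h : τ.SatisfiesConjugateRelations X ξ) (j : Fin n) :
    (τ.tracialRep X hX).IsConjugateVariable j (ξ j) := by
  intro P
  rw [tracialRep_emb, NCPoly.ev_adjoint X hX, ← traceMul, ← h j P, NCPoly.leftDeriv,
    LinearMap.comp_apply]
  induction NCPoly.pderiv j P using TensorProduct.induction_on with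
  | zero => simp
  | tmul a b =>
    rw [NCPoly.leftSlice_tmul, map_smul, tracialRep_trace, tracialRep_trace,
      Algebra.TensorProduct.map_tmul, tensorTrace, LinearMap.comp_apply, TensorProduct.map_tmul,
      LinearMap.mul'_apply, smul_eq_mul]
  | add s t hs ht => rw [map_add, map_add, hs, ht, map_add, map_add]

theorem exists_isConjugateSystem (hΦ : τ.freeFisherInformation X < ∞) :
    ∃ ξ : Fin n → τ.L2, τ.IsConjugateSystem X ξ := by
  by_contra h
  rw [freeFisherInformation, dif_neg h] at hΦ
  exact lt_irrefl _ hΦ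

end FaithfulNormalTracialState

end

/-! ### Measures with prescribed moments -/

section

/-- A measure whose moments grow at most geometrically is determined by its moments: its
characteristic function is the sum of its moment series. -/
theorem MeasureTheory.Measure.ext_of_moments {μ ν : Measure ℝ} [IsProbabilityMeasure μ]
    [IsProbabilityMeasure ν] (hμ : ∀ k : ℕ, Integrable (fun t : ℝ => t ^ k) μ)
    (hν : ∀ k : ℕ, Integrable (fun t : ℝ => t ^ k) ν)
    (h : ∀ k : ℕ, ∫ t : ℝ, t ^ k ∂μ = ∫ t : ℝ, t ^ k ∂ν) {C : ℝ}
    (hC : ∀ k : ℕ, ∫ t : ℝ, t ^ k ∂μ ≤ C ^ k) : μ = ν := by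
  have key : ∀ (κ : Measure ℝ) [IsProbabilityMeasure κ],
      (∀ k : ℕ, Integrable (fun t : ℝ => t ^ k) κ) → (∀ k : ℕ, ∫ t : ℝ, t ^ k ∂κ ≤ C ^ k) →
      ∀ s : ℝ, HasSum (fun k : ℕ => (s * Complex.I) ^ k / (k.factorial : ℂ) *
        ((∫ t : ℝ, t ^ k ∂κ : ℝ) : ℂ)) (charFun κ s) := by
    intro κ _ hκ hCκ s
    set F : ℕ → ℝ → ℂ := fun k t =>
      (s * Complex.I) ^ k / (k.factorial : ℂ) * ((t ^ k : ℝ) : ℂ) with hF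
    have hint : ∀ k, Integrable (F k) κ := fun k => (hκ k).ofReal.const_mul _
    have habs : ∀ k : ℕ, ∫ t : ℝ, |t ^ k| ∂κ ≤ 1 + (C ^ 2) ^ k := by
      intro k
      have h1 : ∫ t : ℝ, |t ^ k| ∂κ ≤ ∫ t : ℝ, (1 + t ^ (2 * k)) ∂κ := by
        refine integral_mono (hκ k).abs ((integrable_const 1).add (hκ (2 * k))) fun t => ?_
        change |t ^ k| ≤ 1 + t ^ (2 * k)
        rw [mul_comm, pow_mul, ← sq_abs (t ^ k)]
        nlinarith [sq_nonneg (|t ^ k| - 1)]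
      rw [integral_add (integrable_const 1) (hκ (2 * k))] at h1
      have h2 := hCκ (2 * k)
      rw [pow_mul] at h2
      simp only [integral_const, probReal_univ, smul_eq_mul, mul_one] at h1
      linarith
    have hsum : Summable fun k => ∫ t, ‖F k t‖ ∂κ := by
      refine Summable.of_nonneg_of_le (fun k => by positivity) (fun k => ?_)
        ((Real.summable_pow_div_factorial |s|).add (Real.summable_pow_div_factorial (|s| * C ^ 2)))
      have h1 : ∀ t, ‖F k t‖ = |s| ^ k / k.factorial * |t ^ k| := by
        intro t
        rw [hF]
        simp only [norm_mul, norm_div, norm_pow, Complex.norm_real, Complex.norm_I, mul_one,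
          Real.norm_eq_abs, Complex.norm_natCast]
        rw [abs_pow]
      simp only [h1]
      rw [integral_const_mul]
      calc |s| ^ k / k.factorial * ∫ t, |t ^ k| ∂κ
          ≤ |s| ^ k / k.factorial * (1 + (C ^ 2) ^ k) := by gcongr; exact habs k
        _ = _ := by rw [mul_pow]; ring
    have := hasSum_integral_of_summable_integral_norm hint hsum
    have e1 : ∫ t, ∑' k, F k t ∂κ = charFun κ s := by
      rw [charFun_apply_real]
      refine integral_congr_ae (Filter.Eventually.of_forall fun t => ?_)
      change ∑' k, F k t = Complex.exp (s * t * Complex.I)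
      rw [Complex.exp_eq_exp_ℂ, NormedSpace.exp_eq_tsum_div]
      refine tsum_congr fun k => ?_
      rw [hF]
      push_cast
      rw [div_mul_eq_mul_div, ← mul_pow]
      ring
    rw [e1] at this
    simpa only [hF, integral_const_mul, integral_complex_ofReal] using this
  refine Measure.ext_of_charFun (funext fun s => ?_)
  have h1 := key μ hμ hC s
  have h2 := key ν hν (fun k => h k ▸ hC k) s
  simp only [h] at h1
  exact h1.unique h2

variable {K : Type*} [NormedAddCommGroup K] [InnerProductSpace ℂ K] [CompleteSpace K]

/-- The scalar spectral measure of a bounded self-adjoint operator, described by its moments. It is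
the Riesz–Markov measure of `f ↦ ⟨y, f(T) y⟩`. -/
theorem ContinuousLinearMap.exists_measure_moments {T : K →L[ℂ] K} (hT : IsSelfAdjoint T) (y : K) :
    ∃ μ : Measure ℝ, IsFiniteMeasure μ ∧ (∀ k : ℕ, Integrable (fun t : ℝ => t ^ k) μ) ∧
      ∀ k : ℕ, ⟪y, (T ^ k) y⟫_ℂ = ((∫ t : ℝ, t ^ k ∂μ : ℝ) : ℂ) := by
  have hcpt : CompactSpace (spectrum ℝ T) := isCompact_iff_compactSpace.mp (spectrum.isCompact T)
  let Λ₀ : C(spectrum ℝ T, ℝ) →ₗ[ℝ] ℝ :=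
    { toFun := fun f => (⟪y, cfcHom hT f y⟫_ℂ).re
      map_add' := fun f g => by
        rw [map_add, add_apply, inner_add_right, Complex.add_re]
      map_smul' := fun c f => by
        rw [map_smul, smul_apply, inner_smul_right_eq_smul, Complex.smul_re, RingHom.id_apply] }
  have hmono : ∀ f g : C(spectrum ℝ T, ℝ), f ≤ g → Λ₀ f ≤ Λ₀ g := fun f g hfg => by
    have := (ContinuousLinearMap.le_def _ _).1 (cfcHom_mono hT hfg)
    have h1 := (this.inner_nonneg_right y)
    rw [← map_sub] at h1
    rw [← sub_nonneg, ← map_sub]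
    exact (Complex.le_def.1 h1).1
  let Λ : CompactlySupportedContinuousMap (spectrum ℝ T) ℝ →ₚ[ℝ] ℝ :=
    { toFun := fun g => Λ₀ (g : C(spectrum ℝ T, ℝ))
      map_add' := fun f g => map_add Λ₀ _ _
      map_smul' := fun c g => map_smul Λ₀ c _
      monotone' := fun f g hfg => hmono _ _ hfg }
  set μ₀ := RealRMK.rieszMeasure Λ
  have hint : ∀ f : C(spectrum ℝ T, ℝ), ∫ t, f t ∂μ₀ = (⟪y, cfcHom hT f y⟫_ℂ).re := by
    intro f
    let f' : CompactlySupportedContinuousMap (spectrum ℝ T) ℝ :=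
      { toFun := f
        hasCompactSupport' := HasCompactSupport.of_compactSpace _ }
    exact RealRMK.integral_rieszMeasure Λ f'
  refine ⟨μ₀.map Subtype.val, inferInstance, fun k => ?_, fun k => ?_⟩
  · rw [integrable_map_measure (by fun_prop) (by fun_prop)]
    exact (BoundedContinuousFunction.mkOfCompact
      (⟨fun t => (t : ℝ) ^ k, by fun_prop⟩ : C(spectrum ℝ T, ℝ))).integrable μ₀
  · have h1 := hint ((ContinuousMap.restrict (spectrum ℝ T) (ContinuousMap.id ℝ)) ^ k)
    rw [map_pow, cfcHom_id] at h1
    rw [integral_map (by fun_prop) (by fun_prop)]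
    have h2 : ∫ t : spectrum ℝ T, (t : ℝ) ^ k ∂μ₀ = (⟪y, (T ^ k) y⟫_ℂ).re := h1
    rw [h2]
    have h3 : star ⟪y, (T ^ k) y⟫_ℂ = ⟪y, (T ^ k) y⟫_ℂ := by
      rw [Complex.star_def, inner_conj_symm, ← ContinuousLinearMap.adjoint_inner_right,
        ← ContinuousLinearMap.star_eq_adjoint, (hT.pow k).star_eq]
    exact (Complex.conj_eq_iff_re.1 h3).symm

end

/-! ### Atoms of the distribution of a polynomial -/

section

variable {n : ℕ} {K : Type*} [NormedAddCommGroup K] [InnerProductSpace ℂ K] [CompleteSpace K]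

namespace TracialRep

open NCPoly Filter Topology

variable {ρ : TracialRep n K}

theorem isSelfAdjoint_rep {P : NCPoly n} (hP : P.adjoint = P) : IsSelfAdjoint (ρ.rep P) := by
  rw [IsSelfAdjoint, ← rep_adjoint, hP]

theorem norm_trace_pow_le (ρ : TracialRep n K) (P : NCPoly n) (k : ℕ) :
    ‖ρ.trace (P ^ k)‖ ≤ ‖ρ.vec‖ ^ 2 * ‖ρ.rep P‖ ^ k := by
  have h : ‖ρ.emb (P ^ k)‖ ≤ ‖ρ.rep P‖ ^ k * ‖ρ.vec‖ := by
    induction k with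
    | zero => simp [emb_apply]
    | succ k ih =>
      rw [pow_succ', pow_succ', mul_assoc]
      exact (ρ.norm_emb_mul_le_rep_mul _ _).trans (by gcongr)
  calc ‖ρ.trace (P ^ k)‖ ≤ ‖ρ.vec‖ * ‖ρ.emb (P ^ k)‖ := norm_inner_le_norm _ _
    _ ≤ ‖ρ.vec‖ * (‖ρ.rep P‖ ^ k * ‖ρ.vec‖) := by gcongr
    _ = _ := by ring

theorem trace_aeval {P : NCPoly n} {μ : Measure ℝ}
    (hint : ∀ k : ℕ, Integrable (fun t : ℝ => t ^ k) μ)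
    (hmom : ∀ k : ℕ, ρ.trace (P ^ k) = ((∫ t : ℝ, t ^ k ∂μ : ℝ) : ℂ)) (p : Polynomial ℝ) :
    Integrable (fun t => p.eval t) μ ∧
      ρ.trace (Polynomial.aeval P (p.map Complex.ofRealHom)) =
        ((∫ t : ℝ, p.eval t ∂μ : ℝ) : ℂ) := by
  induction p using Polynomial.induction_on' with
  | add p q hp hq =>
    simp only [Polynomial.eval_add, Polynomial.map_add, map_add]
    refine ⟨hp.1.add hq.1, ?_⟩
    rw [hp.2, hq.2, integral_add hp.1 hq.1, Complex.ofReal_add]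
  | monomial k c =>
    simp only [Polynomial.eval_monomial, Polynomial.map_monomial, Polynomial.aeval_monomial]
    refine ⟨(hint k).const_mul c, ?_⟩
    rw [← Algebra.smul_def, map_smul, hmom, integral_const_mul, Complex.ofReal_mul]
    rfl

/-- An atom at `t` would force `τ((1 - c² (P - t)²)^(2k)) ≥ μ {t}` for all `k`, where `c (P - t)` is
a contraction; but these traces tend to the trace of the kernel projection of `P - t`, which is
zero. -/
theorem measure_singleton_eq_zero (hξ : ∀ j, ∃ ξ, ρ.IsConjugateVariable j ξ) {P : NCPoly n}
    (hP : P.adjoint = P) (hPnc : ∀ c : ℂ, P ≠ algebraMap ℂ (NCPoly n) c) {μ : Measure ℝ}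
    [IsFiniteMeasure μ] (hint : ∀ k : ℕ, Integrable (fun t : ℝ => t ^ k) μ)
    (hmom : ∀ k : ℕ, ρ.trace (P ^ k) = ((∫ t : ℝ, t ^ k ∂μ : ℝ) : ℂ)) (t : ℝ) :
    μ {t} = 0 := by
  set Q : NCPoly n := P - algebraMap ℂ (NCPoly n) (t : ℂ) with hQ
  set c : ℝ := (‖ρ.rep Q‖ + 1)⁻¹ with hc
  have hc0 : 0 < c := by positivity
  set x : NCPoly n := (c : ℂ) • Q with hx
  have hxadj : x.adjoint = x := by
    rw [hx, adjoint_smul, Complex.conj_ofReal, hQ, adjoint_sub, hP, Algebra.algebraMap_eq_smul_one,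
      adjoint_smul, adjoint_one, Complex.conj_ofReal]
  have hx0 : x ≠ 0 :=
    smul_ne_zero (Complex.ofReal_ne_zero.2 hc0.ne') (sub_ne_zero.2 (hPnc t))
  have hx1 : ‖ρ.rep x‖ ≤ 1 := by
    rw [hx, map_smul, norm_smul, Complex.norm_real, Real.norm_of_nonneg hc0.le, hc,
      inv_mul_le_iff₀ (by positivity)]
    linarith
  set p : Polynomial ℝ :=
    1 - (Polynomial.C c * (Polynomial.X - Polynomial.C t)) ^ 2 with hp
  have hpx : Polynomial.aeval P (p.map Complex.ofRealHom) = x.defect := by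
    rw [defect, hxadj, ← sq, hx, hQ, Algebra.smul_def]
    simp [hp]
  have hle : ∀ k : ℕ, μ.real {t} ≤ ‖ρ.emb (x.defect ^ k)‖ ^ 2 := by
    intro k
    obtain ⟨hi, htr⟩ := trace_aeval hint hmom (p ^ (2 * k))
    rw [Polynomial.map_pow, map_pow, hpx, trace_defect_pow_two_mul] at htr
    rw [Complex.ofReal_injective htr]
    have h1 : μ.real {t} = ∫ s, Set.indicator {t} (fun _ => (1 : ℝ)) s ∂μ := by
      rw [integral_indicator (measurableSet_singleton t)]
      simp [Measure.real]
    rw [h1]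
    refine integral_mono ((integrable_const 1).indicator (measurableSet_singleton t)) hi
      fun s => ?_
    change Set.indicator {t} (fun _ => (1 : ℝ)) s ≤ _
    rw [Set.indicator_apply]
    split_ifs with hs
    · rw [Set.mem_singleton_iff.1 hs]
      simp [hp]
    · simp only [Polynomial.eval_pow, pow_mul]
      positivity
  have hlim := (tendsto_emb_defect_pow hξ Nat.hyperfilter_le_atTop hx0 hx1).pow 2
  rw [zero_pow two_ne_zero] at hlim
  have h0 : μ.real {t} ≤ 0 := ge_of_tendsto' hlim hle
  exact (measureReal_eq_zero_iff).1 (h0.antisymm measureReal_nonneg)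

end TracialRep

end

theorem mainTheorem3 {H : Type*} [NormedAddCommGroup H] [InnerProductSpace ℂ H] [CompleteSpace H]
    (M : VonNeumannAlgebra H) (τ : FaithfulNormalTracialState M) (n : ℕ)
    (X : Fin n → M.toStarSubalgebra) (hX : ∀ j, IsSelfAdjoint (X j))
    (hΦ : τ.freeFisherInformation X < ∞)
    (P : NCPoly n) (hPsa : P.adjoint = P) (hPnc : ∀ c : ℂ, P ≠ algebraMap ℂ (NCPoly n) c) :
    ∃ μ : Measure ℝ, τ.IsDistribution (NCPoly.ev X P) μ ∧
      (∀ ν : Measure ℝ, τ.IsDistribution (NCPoly.ev X P) ν → ν = μ) ∧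
      ∀ t : ℝ, μ {t} = 0 := by
  obtain ⟨ξ, hξ⟩ := τ.exists_isConjugateSystem hΦ
  set ρ := τ.tracialRep X hX with hρ
  have htr : ∀ k : ℕ, ρ.trace (P ^ k) = τ.toLinearMap (NCPoly.ev X P ^ k) := fun k => by
    rw [hρ, τ.tracialRep_trace hX, map_pow]
  obtain ⟨μ, hfin, hint, hmom⟩ :=
    ContinuousLinearMap.exists_measure_moments (TracialRep.isSelfAdjoint_rep (ρ := ρ) hPsa) ρ.vec
  have hmom' : ∀ k : ℕ, ρ.trace (P ^ k) = ((∫ t : ℝ, t ^ k ∂μ : ℝ) : ℂ) := fun k => by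
    rw [← hmom, ← map_pow]; rfl
  have hprob : IsProbabilityMeasure μ := by
    have h := (htr 0).symm.trans (hmom' 0)
    rw [pow_zero, τ.map_one] at h
    have h1 : (1 : ℝ) = μ.real Set.univ := by
      have := Complex.ofReal_injective (h : ((1 : ℝ) : ℂ) = _)
      simpa using this
    exact ⟨by rw [← ENNReal.toReal_eq_one_iff]; exact h1.symm⟩
  refine ⟨μ, ⟨hprob, hint, fun k => (htr k).symm.trans (hmom' k)⟩, fun ν hν => ?_,
    TracialRep.measure_singleton_eq_zero (fun j => ⟨ξ j, hξ.1.isConjugateVariable hX j⟩)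
      hPsa hPnc hint hmom'⟩
  have := hν.isProbabilityMeasure
  have hνmom : ∀ k : ℕ, ∫ t : ℝ, t ^ k ∂μ = ∫ t : ℝ, t ^ k ∂ν := fun k =>
    Complex.ofReal_injective ((hmom' k).symm.trans ((htr k).trans (hν.moment k)))
  have hvec : ‖ρ.vec‖ ^ 2 = 1 := by
    have h := τ.norm_toL2_sq 1
    rw [star_one, one_mul, τ.map_one] at h
    exact Complex.ofReal_injective h
  refine (Measure.ext_of_moments hint hν.integrable hνmom (C := ‖ρ.rep P‖) fun k => ?_).symm
  have h := ρ.norm_trace_pow_le P k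
  rw [hmom', Complex.norm_real, hvec, one_mul] at h
  exact (le_abs_self _).trans h
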